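/- A switch graph is a tuple $G=(V,E,s_0,s_1)$ with $V$ a finite set, $s_0,s_1:V\to V$ (the even and the odd successor) and $E=\{(v,s_0(v)):v\in V\}\cup\{(v,s_1(v)):v\in V\}$; loops, and $s_0(v)=s_1(v)$, are allowed. Let $n=|V|$. For $o,d\in V$, the procedure $\mathrm{Run}(G,o,d)$ is the following. Initially $v:=o$, $\mathrm{s\_curr}[u]:=s_0(u)$ and $\mathrm{s\_next}[u]:=s_1(u)$ for all $u\in V$; while $v\neq d$: let $w:=\mathrm{s\_curr}[v]$, swap $\mathrm{s\_curr}[v]$ and $\mathrm{s\_next}[v]$, and set $v:=w$ (the edge $(v,w)$ is traversed). Problem ARRIVAL is to decide, given $(G,o,d)$, whether $\mathrm{Run}(G,o,d)$ terminates. As a formal language it consists of the words that encode such an instance, where $V=\{0,\dots,n-1\}$ and the instance is encoded by listing $o,d,s_0(0),s_1(0),\dots,s_0(n-1),s_1(n-1)$ in binary, each number followed by a separator symbol. For $o\ne d$, a switching flow is a function $x:E\to\mathbb{N}_0$ such that for all $v\in V$ $$\sum_{e\in E^+(v)}x_e-\sum_{e\in E^-(v)}x_e=\begin{cases}1,&v=o,\\-1,&v=d,\\0,&\text{otherwise,}\end{cases}\qquad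 0\le x_{(v,s_1(v))}\le x_{(v,s_0(v))}\le x_{(v,s_1(v))}+1,$$ where $E^+(v)$ and $E^-(v)$ are the sets of outgoing and incoming edges at $v$. **Theorem.** Problem ARRIVAL is in $\mathrm{NP}$: there are a verifier running in polynomial time on a Turing machine and a polynomial $p$ such that a word $w$ belongs to ARRIVAL if and only if the verifier accepts $(w,c)$ for some certificate $c$ of length at most $p(|w|)$. Moreover, for every instance with $o\neq d$, $\mathrm{Run}(G,o,d)$ terminates if and only if there exists a switching flow. If it terminates, then the run profile, which assigns to each edge the number of times it is traversed during $\mathrm{Run}(G,o,d)$, is a switching flow, and each of its entries is at most $n2^n$. -/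

import Mathlib

namespace Arrival

/-! ### Switch graphs and the train run -/

/-- A switch graph on the vertex set `V`: the even successor `s₀ v` and the odd successor `s₁ v`
of every vertex (loops and `s₀ v = s₁ v` are allowed). -/
structure SwitchGraph (V : Type*) where
  s₀ : V → V
  s₁ : V → V

/-- The variables of the procedure `Run`: the current location of the train and the two arrays
`s_curr`, `s_next`. -/
structure RunState (V : Type*) where
  loc : V
  curr : V → V
  next : V → V

namespace SwitchGraph

variable {V : Type*} [DecidableEq V] (G : SwitchGraph V)

/-- The body of the while loop of `Run`: `w := s_curr[v]; swap (s_curr[v], s_next[v]); v := w`. -/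
def loopBody (S : RunState V) : RunState V where
  loc := S.curr S.loc
  curr := Function.update S.curr S.loc (S.next S.loc)
  next := Function.update S.next S.loc (S.curr S.loc)

/-- The variables of `Run` after `k` executions of the loop body, starting at `o`. -/
def runState (o : V) (k : ℕ) : RunState V :=
  loopBody^[k] ⟨o, G.s₀, G.s₁⟩

/-- `Run(G, o, d)` terminates: after finitely many executions of the loop body the loop condition
`v ≠ d` fails. -/
def Terminates (o d : V) : Prop :=
  ∃ k, (G.runState o k).loc = d

/-- The number of executions of the loop body in `Run(G, o, d)`, if this procedure terminates. -/
noncomputable def runLength (o d : V) : ℕ :=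
  sInf {k | (G.runState o k).loc = d}

variable [Fintype V]

/-- The edge set `E = {(v, s₀ v)} ∪ {(v, s₁ v)}`. -/
def edges : Finset (V × V) :=
  Finset.univ.image (fun v => (v, G.s₀ v)) ∪ Finset.univ.image (fun v => (v, G.s₁ v))

/-- The edge from `v` to its even successor. -/
def evenEdge (v : V) : G.edges :=
  ⟨(v, G.s₀ v), by simp [edges]⟩

/-- The edge from `v` to its odd successor. -/
def oddEdge (v : V) : G.edges :=
  ⟨(v, G.s₁ v), by simp [edges]⟩

/-- A switching flow with respect to `o` and `d`: flow conservation and the balancing condition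
hold at every vertex. -/
def IsSwitchingFlow (o d : V) (x : G.edges → ℕ) : Prop :=
  ∀ v : V,
    (∑ e : G.edges with e.1.1 = v, (x e : ℤ)) - (∑ e : G.edges with e.1.2 = v, (x e : ℤ)) =
        (if v = o then 1 else if v = d then -1 else 0) ∧
      x (G.oddEdge v) ≤ x (G.evenEdge v) ∧ x (G.evenEdge v) ≤ x (G.oddEdge v) + 1

/-- The run profile of a terminating `Run(G, o, d)`: the number of times each edge is traversed. -/
noncomputable def runProfile (o d : V) (e : G.edges) : ℕ :=
  ((Finset.range (G.runLength o d)).filter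
    (fun k => ((G.runState o k).loc, (G.runState o (k + 1)).loc) = e.1)).card

end SwitchGraph

/-! ### The problem ARRIVAL as a formal language -/

/-- An instance `(G, o, d)` of ARRIVAL; the `n` vertices are numbered `0, …, n - 1`. -/
structure Instance where
  n : ℕ
  G : SwitchGraph (Fin n)
  o : Fin n
  d : Fin n

/-- A number in binary (least significant bit first), followed by the separator `none`. -/
def encodeNumber (k : ℕ) : List (Option Bool) :=
  k.bits.map some ++ [none]

/-- The numbers of the vertices `o, d, s₀ 0, s₁ 0, s₀ 1, s₁ 1, …, s₀ (n - 1), s₁ (n - 1)`. -/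
def Instance.numbers (I : Instance) : List ℕ :=
  I.o.val :: I.d.val ::
    (List.finRange I.n).flatMap (fun v => [(I.G.s₀ v).val, (I.G.s₁ v).val])

/-- The word over the alphabet `{0, 1, separator}` that encodes an instance. -/
def Instance.encode (I : Instance) : List (Option Bool) :=
  I.numbers.flatMap encodeNumber

theorem encodeNumber_append_inj {j k : ℕ} {u v : List (Option Bool)}
    (h : encodeNumber j ++ u = encodeNumber k ++ v) : j = k ∧ u = v := by
  have key : ∀ a b : List Bool, a.map some ++ ([none] ++ u) = b.map some ++ ([none] ++ v) →
      a = b ∧ u = v := by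
    intro a
    induction a with
    | nil => intro b hb; cases b <;> simp_all
    | cons x a ih =>
      intro b hb
      cases b with
      | nil => simp at hb
      | cons y b =>
        simp only [List.map_cons, List.cons_append, List.cons.injEq, Option.some.injEq] at hb
        have := ih b hb.2
        exact ⟨by rw [hb.1, this.1], this.2⟩
  have h' := key j.bits k.bits (by simpa [encodeNumber] using h)
  refine ⟨?_, h'.2⟩
  have := congrArg (List.foldr Nat.bit 0) h'.1
  have hb : ∀ m : ℕ, m.bits.foldr Nat.bit 0 = m := by
    intro m
    induction m using Nat.binaryRec' with
    | zero => simp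
    | bit b m hm ih => rw [Nat.bits_append_bit m b hm, List.foldr_cons, ih]
  rwa [hb, hb] at this

theorem flatMap_encodeNumber_injective :
    Function.Injective (fun l : List ℕ => l.flatMap encodeNumber) := by
  intro l
  induction l with
  | nil => intro m h; cases m <;> simp_all [encodeNumber]
  | cons a l ih =>
    intro m h
    cases m with
    | nil => simp [encodeNumber] at h
    | cons b m =>
      simp only [List.flatMap_cons] at h
      obtain ⟨h₁, h₂⟩ := encodeNumber_append_inj h
      rw [h₁, ih h₂]

/-- Different instances have different encodings. -/
theorem Instance.encode_injective : Function.Injective Instance.encode := by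
  intro I J h
  have h := flatMap_encodeNumber_injective h
  obtain ⟨n, ⟨s, t⟩, o, d⟩ := I
  obtain ⟨m, ⟨s', t'⟩, o', d'⟩ := J
  simp only [numbers, List.cons.injEq] at h
  obtain ⟨ho, hd, h⟩ := h
  have hn : n = m := by
    have := congrArg List.length h
    simp [List.length_flatMap] at this
    omega
  subst hn
  have hf : ∀ l : List (Fin n),
      l.flatMap (fun v => [(s v).val, (t v).val]) = l.flatMap (fun v => [(s' v).val, (t' v).val]) →
      ∀ v ∈ l, s v = s' v ∧ t v = t' v := by
    intro l
    induction l with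
    | nil => simp
    | cons a l ih =>
      intro hl v hv
      simp only [List.flatMap_cons, List.cons_append, List.nil_append, List.cons.injEq] at hl
      rcases List.mem_cons.1 hv with rfl | hv
      · exact ⟨Fin.ext hl.1, Fin.ext hl.2.1⟩
      · exact ih hl.2.2 v hv
  have hs : s = s' := funext fun v => (hf _ h v (List.mem_finRange v)).1
  have ht : t = t' := funext fun v => (hf _ h v (List.mem_finRange v)).2
  rw [hs, ht, Fin.ext ho, Fin.ext hd]

/-- ARRIVAL: the set of all encodings of instances `(G, o, d)` for which `Run(G, o, d)`
terminates. -/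
def ARRIVAL : Language (Option Bool) :=
  {w | ∃ I : Instance, I.encode = w ∧ I.G.Terminates I.o I.d}

/-! ### The complexity class NP -/

/-- The class `NP` of languages over a finite alphabet `Γ`: there are a verifier `V`, computed in
polynomial time by a (multi-stack) Turing machine that reads the word and the certificate, and a
polynomial `p`, such that a word `w` is in the language if and only if `V` accepts `w` together
with some certificate of length at most `p (|w|)`. Certificates are words over a finite alphabet
`Δ`. -/
def NP (Γ : Type) [Fintype Γ] : Set (Language Γ) :=
  {L | ∃ (Δ : Type) (_ : Fintype Δ) (V : List Γ × List Δ → Bool) (p : Polynomial ℕ),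
    Nonempty (Turing.TM2ComputableInPolyTime
      (Computability.encodingProd
        (Computability.encodingList Γ) (Computability.encodingList Δ)).encode
      Computability.encodeBool V) ∧
    ∀ w : List Γ, w ∈ L ↔ ∃ c : List Δ, c.length ≤ p.eval w.length ∧ V (w, c) = true}

end Arrival

/-! Let `t v` count the departures of the train from `v`. Departures alternate, so `(t v + 1) / 2`
of them go to the even successor and `t v / 2` to the odd one. For `o ≠ d`, switching flows
therefore correspond to solutions `t` of the conservation equations `IsVisits`
(`IsSwitchingFlow.isSplit`, `IsSplit.isSwitchingFlow_iff`). The visit counts of a terminating run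
are a solution. Conversely, given any solution `t`, the visit counts stay below `t` as long as the
train has not reached `d`, because inflow is monotone. They add up to the number of steps, so the
run must stop (`IsVisits.terminates`). A terminating run repeats no state, and a state is determined
by the location and the parities of the visit counts. This bounds its length, and hence the run
profile, by `n * 2 ^ n` (`runLength_le`).

For membership in NP, the certificate is not the flow itself but the transcript of a computation: a
sequence of stack instructions that lies in a regular language and can be executed on the input. A
machine executes the transcript while a DFA checks its form (`mem_NP_of_stackProgram`). A
nondeterministic program is thus a regular expression over instructions, and its guesses are part of
the transcript.

The program for ARRIVAL keeps a ledger of signed tokens. A word with `j` leading ticks stands for `2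
^ j` units at the place named by the rest. The places `name u` record conservation of flow at the
vertex `u`. The places `.star :: name u` record that every number in the input is the canonical
number of a vertex. Finally the ledger has to be emptied by moving tokens, cancelling opposite ones
and merging equal ones. These steps preserve the value under every valuation that doubles with each
tick, so an emptied ledger proves all the equations (`verifier_sound`, `mem_ARRIVAL_of_verifier`).
Conversely, a nonempty ledger of value zero contains two tokens with the same word, by a 2-adic
argument (`not_nodup_of_total_eq_zero`), so it can be shrunk until it is empty (`reduce_complete`).
Ticks allow exponentially large counts to be posted bit by bit in polynomial time
(`fire_star_complete`). -/

/-! ### Kleene's theorem: regular expressions match regular languages -/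

namespace Language

open scoped Computability

variable {α : Type*}

/-- The cut between the two factors of `x ++ y` falls either inside `y` or inside `x`. -/
theorem mem_leftQuotient_mul {L M : Language α} {x y : List α} :
    y ∈ (L * M).leftQuotient x ↔ y ∈ L.leftQuotient x * M ∨
      ∃ q, (∃ x₁ x₂, x = x₁ ++ x₂ ∧ x₁ ∈ L ∧ q = M.leftQuotient x₂) ∧ y ∈ q := by
  simp only [mem_leftQuotient, mem_mul]
  constructor
  · rintro ⟨a, ha, b, hb, hab⟩
    rcases List.append_eq_append_iff.1 hab with ⟨c, rfl, rfl⟩ | ⟨c, rfl, rfl⟩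
    · exact Or.inr ⟨_, ⟨a, c, rfl, ha, rfl⟩, hb⟩
    · exact Or.inl ⟨c, ha, b, hb, rfl⟩
  · rintro (⟨c, hc, b, hb, rfl⟩ | ⟨_, ⟨a, c, rfl, ha, rfl⟩, hy⟩)
    · exact ⟨_, hc, b, hb, by simp⟩
    · exact ⟨a, ha, _, hy, by simp⟩

/-- By Myhill–Nerode it suffices that there are finitely many left quotients. Each one is determined
by a left quotient of `L` and a set of left quotients of `M`. -/
theorem IsRegular.mul {L M : Language α} (hL : L.IsRegular) (hM : M.IsRegular) :
    (L * M).IsRegular := by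
  rw [isRegular_iff_finite_range_leftQuotient] at *
  refine ((hL.prod hM.powerset).image
    (fun p : Language α × Set (Language α) => p.1 * M + (sSup p.2 : Language α))).subset ?_
  rintro _ ⟨x, rfl⟩
  refine ⟨(L.leftQuotient x, {q | ∃ x₁ x₂, x = x₁ ++ x₂ ∧ x₁ ∈ L ∧ q = M.leftQuotient x₂}),
    ⟨⟨x, rfl⟩, ?_⟩, ?_⟩
  · rintro _ ⟨_, x₂, _, _, rfl⟩
    exact ⟨x₂, rfl⟩
  · ext y
    rw [mem_leftQuotient_mul, mem_add]
    exact or_congr Iff.rfl Set.mem_sUnion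

/-- One factor of the decomposition of `x ++ y` contains the end of `x`; it is split as `x₂ ++ y₁`.
For `x = []` there need not be such a factor. -/
theorem mem_leftQuotient_kstar {L : Language α} {x y : List α} (hx : x ≠ []) :
    y ∈ L∗.leftQuotient x ↔
      ∃ x₁ x₂ y₁ y₂, x = x₁ ++ x₂ ∧ x₁ ∈ L∗ ∧ y = y₁ ++ y₂ ∧ x₂ ++ y₁ ∈ L ∧ y₂ ∈ L∗ := by
  rw [mem_leftQuotient]
  constructor
  · rintro ⟨S, hS, hL⟩
    induction S generalizing x with
    | nil => simp_all
    | cons a S ih =>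
      simp only [List.mem_cons, forall_eq_or_imp] at hL
      rw [List.flatten_cons] at hS
      rcases List.append_eq_append_iff.1 hS with ⟨c, rfl, rfl⟩ | ⟨c, rfl, h⟩
      · exact ⟨[], x, c, S.flatten, rfl, nil_mem_kstar _, rfl, hL.1, join_mem_kstar hL.2⟩
      · rcases eq_or_ne c [] with rfl | hc
        · exact ⟨[], a, [], y, by simp, nil_mem_kstar _, rfl, by simpa using hL.1,
            ⟨S, by simpa using h.symm, hL.2⟩⟩
        · obtain ⟨x₁, x₂, y₁, y₂, rfl, ⟨T, rfl, hT⟩, rfl, h₁, h₂⟩ := ih hc h.symm hL.2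
          exact ⟨a ++ T.flatten, x₂, y₁, y₂, by simp,
            ⟨a :: T, by simp, by simpa using ⟨hL.1, hT⟩⟩, rfl, h₁, h₂⟩
  · rintro ⟨x₁, x₂, y₁, y₂, rfl, ⟨S, rfl, hS⟩, rfl, h, ⟨T, rfl, hT⟩⟩
    exact ⟨S ++ [x₂ ++ y₁] ++ T, by simp, by simp; grind⟩

theorem IsRegular.kstar {L : Language α} (hL : L.IsRegular) : L∗.IsRegular := by
  rw [isRegular_iff_finite_range_leftQuotient] at *
  refine (((hL.powerset).image
    (fun p : Set (Language α) => (sSup p : Language α) * L∗)).insert L∗).subset ?_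
  rintro _ ⟨x, rfl⟩
  rcases eq_or_ne x [] with rfl | hx
  · exact Or.inl rfl
  · refine Or.inr ⟨{q | ∃ x₁ x₂, x = x₁ ++ x₂ ∧ x₁ ∈ L∗ ∧ q = L.leftQuotient x₂}, ?_, ?_⟩
    · rintro _ ⟨_, x₂, _, _, rfl⟩
      exact ⟨x₂, rfl⟩
    · ext y
      rw [mem_leftQuotient_kstar hx, mem_mul]
      constructor
      · rintro ⟨y₁, hy₁, y₂, hy₂, rfl⟩
        obtain ⟨_, ⟨x₁, x₂, rfl, h, rfl⟩, h'⟩ := Set.mem_sUnion.1 hy₁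
        exact ⟨x₁, x₂, y₁, y₂, rfl, h, rfl, h', hy₂⟩
      · rintro ⟨x₁, x₂, y₁, y₂, rfl, h, rfl, h', hy₂⟩
        exact ⟨y₁, Set.mem_sUnion.2 ⟨_, ⟨x₁, x₂, rfl, h, rfl⟩, h'⟩, y₂, hy₂, rfl⟩

/-- Every left quotient consists of suffixes of words of `L`, and there are finitely many of these.
-/
theorem IsRegular.of_finite {L : Language α} (hL : Set.Finite (L : Set (List α))) :
    L.IsRegular := by
  classical
  rw [isRegular_iff_finite_range_leftQuotient]
  have hs : Set.Finite (⋃ w ∈ (L : Set (List α)), {z : List α | z <:+ w}) :=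
    hL.biUnion fun w _ => by
      refine (w.tails.toFinset.finite_toSet).subset fun z hz => ?_
      simpa using hz
  refine hs.powerset.subset ?_
  rintro _ ⟨x, rfl⟩ y hy
  exact Set.mem_biUnion (show x ++ y ∈ (L : Set (List α)) from hy) ⟨x, rfl⟩

end Language

/-- This supplies the DFA that the machine runs alongside a program given as a regular expression.
-/
theorem RegularExpression.isRegular_matches' {α : Type*} (P : RegularExpression α) :
    P.matches'.IsRegular := by
  induction P with
  | zero => exact .of_finite Set.finite_empty
  | epsilon => exact .of_finite (Set.finite_singleton [])
  | char a => exact .of_finite (Set.finite_singleton [a])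
  | plus P Q hP hQ => exact hP.add hQ
  | comp P Q hP hQ => exact hP.mul hQ
  | star P hP => exact hP.kstar

namespace Arrival

/-! ### Nondeterministic stack programs -/

/-- The instructions of a stack program: push a symbol, remove a prescribed top symbol, test whether
a stack is empty. -/
inductive StackOp (K A : Type)
  | push (k : K) (a : A)
  | pop (k : K) (a : A)
  | empty (k : K)
  deriving Fintype

namespace StackOp

variable {K A : Type} [DecidableEq K]

/-- The effect of an instruction on the stacks. -/
def apply : StackOp K A → (K → List A) → K → List A
  | push k a, S => Function.update S k (a :: S k)
  | pop k _, S => Function.update S k (S k).tail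
  | empty _, S => S

theorem length_apply_le (o : StackOp K A) (S : K → List A) (k : K) :
    (o.apply S k).length ≤ (S k).length + 1 := by
  cases o with
  | empty => simp [apply]
  | push k' a => by_cases h : k = k' <;> simp [apply, h]
  | pop k' a =>
    by_cases h : k = k' <;> simp [apply, h]
    omega

variable [DecidableEq A]

/-- Whether an instruction is applicable. -/
def ok : StackOp K A → (K → List A) → Bool
  | push _ _, _ => true
  | pop k a, S => decide ((S k).head? = some a)
  | empty k, S => decide ((S k).head? = none)

/-- Execution of a sequence of instructions, which fails if one of them is not applicable. -/
def exec : List (StackOp K A) → (K → List A) → Option (K → List A)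
  | [], S => some S
  | o :: c, S => if o.ok S then exec c (o.apply S) else none

theorem exec_append (c d : List (StackOp K A)) (S : K → List A) :
    exec (c ++ d) S = (exec c S).bind (exec d) := by
  induction c generalizing S with
  | nil => rfl
  | cons o c ih =>
    simp only [List.cons_append, exec]
    split_ifs <;> simp [ih]

end StackOp

/-! ### The Turing machine that executes a stack program given by a certificate -/

namespace Executor

open Turing

variable (K A Γ Q : Type)

/-- The stacks of the machine: input, output, and the stacks of the program. -/
abbrev Stk := Option (Option K)

/-- The alphabets of the stacks. -/
@[reducible] def Alph : Stk K → Type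
  | none => Γ ⊕ StackOp K A
  | some none => Bool
  | some (some _) => A

/-- The labels of the machine: read the input, clean up, execute an instruction. -/
abbrev Label := Option (Option (StackOp K A))

/-- The internal state: the state of the automaton that reads the instructions, whether no
instruction has failed, the symbol just read, and whether a nonempty stack has been seen. -/
structure State where
  q : Q
  good : Bool
  sym : Option (Γ ⊕ StackOp K A)
  seen : Bool
  deriving Fintype

variable {K A Γ Q} [DecidableEq K] [DecidableEq A]

/-- Pop all stacks in a list, recording whether one of them was nonempty. -/
def popAll : List K → TM2.Stmt (Alph K A Γ) (Label K A) (State K A Γ Q) →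
    TM2.Stmt (Alph K A Γ) (Label K A) (State K A Γ Q)
  | [], s => s
  | k :: ks, s =>
    .pop (some (some k)) (fun v a => { v with seen := v.seen || a.isSome }) (popAll ks s)

/-- The statements that execute an instruction. -/
def execStmt : StackOp K A → TM2.Stmt (Alph K A Γ) (Label K A) (State K A Γ Q)
  | .push k a => .push (some (some k)) (fun _ => a) (.goto fun _ => none)
  | .pop k a => .pop (some (some k))
      (fun v b => { v with good := v.good && decide (b = some a) }) (.goto fun _ => none)
  | .empty k => .peek (some (some k))
      (fun v b => { v with good := v.good && decide (b = none) }) (.goto fun _ => none)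

variable [Inhabited A] (D : DFA (StackOp K A) Q) [DecidablePred (· ∈ D.accept)] (k₀ : K)
  (e : Γ → A) (ks : List K)

/-- The program of the machine. -/
def stmt : Label K A → TM2.Stmt (Alph K A Γ) (Label K A) (State K A Γ Q)
  | none =>
    .pop none (fun v a => { v with sym := a })
      (.branch (fun v => v.sym.any Sum.isLeft)
        (.push (some (some k₀)) (fun v => (v.sym.bind Sum.getLeft?).elim default e)
          (.load (fun v => { v with sym := none }) (.goto fun _ => none)))
        (.goto fun v => some (v.sym.bind Sum.getRight?)))
  | some (some o) => .load (fun v => { v with q := D.step v.q o, sym := none }) (execStmt o)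
  | some none =>
    .load (fun v => { v with seen := false }) (popAll ks
      (.branch (fun v => v.seen) (.goto fun _ => some none)
        (.push (some none) (fun v => v.good && decide (v.q ∈ D.accept))
          (.load (fun _ => ⟨D.start, true, none, false⟩) .halt))))

/-- The contents of all stacks. -/
def conf (i : List (Γ ⊕ StackOp K A)) (b : List Bool) (T : K → List A) :
    ∀ k, List (Alph K A Γ k)
  | none => i
  | some none => b
  | some (some k) => T k

omit [DecidableEq A] [Inhabited A] in
@[simp] theorem update_conf_input (i i' b) (T : K → List A) :
    Function.update (conf (Γ := Γ) i b T) none i' = conf i' b T := by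
  funext k; rcases k with _ | _ | k <;> simp [conf]

omit [DecidableEq A] [Inhabited A] in
@[simp] theorem update_conf_output (i b b') (T : K → List A) :
    Function.update (conf (Γ := Γ) i b T) (some none) b' = conf i b' T := by
  funext k; rcases k with _ | _ | k <;> simp [conf]

omit [DecidableEq A] [Inhabited A] in
@[simp] theorem update_conf_work (i b) (T : K → List A) (k : K) (l : List A) :
    Function.update (conf (Γ := Γ) i b T) (some (some k)) l =
      conf i b (Function.update T k l) := by
  funext j
  rcases j with _ | _ | j <;> simp only [conf, Function.update_apply]
  · simp; rfl
  · simp; rfl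
  · by_cases h : j = k
    · subst h; simp
    · rw [Function.update_of_ne (by simpa using h)]; simp [h]; rfl

/-- The Turing machine. -/
@[reducible] def machine [Fintype K] [Fintype A] [Fintype Γ] [Fintype Q] : FinTM2 where
  K := Stk K
  k₀ := none
  k₁ := some none
  Γ := Alph K A Γ
  Λ := Label K A
  main := none
  σ := State K A Γ Q
  initialState := ⟨D.start, true, none, false⟩
  m := stmt D k₀ e ks
  Γk₀Fin := inferInstanceAs (Fintype (Γ ⊕ StackOp K A))

/-- `n` steps of the machine. -/
abbrev steps (n : ℕ) : Option (TM2.Cfg (Alph K A Γ) (Label K A) (State K A Γ Q)) →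
    Option (TM2.Cfg (Alph K A Γ) (Label K A) (State K A Γ Q)) :=
  (flip bind (TM2.step (stmt D k₀ e ks)))^[n]

/-- Pushing one symbol after the other reverses the word, so a program starts with its input upside
down. -/
theorem steps_read_word (w : List Γ) (i b) (T : K → List A) (q : Q) :
    steps D k₀ e ks w.length
      (some ⟨some none, ⟨q, true, none, false⟩, conf (w.map Sum.inl ++ i) b T⟩) =
      some ⟨some none, ⟨q, true, none, false⟩,
        conf i b (Function.update T k₀ ((w.map e).reverse ++ T k₀))⟩ := by
  induction w generalizing T with
  | nil => simp [steps]
  | cons g w ih =>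
    rw [List.length_cons, steps, Function.iterate_succ_apply]
    have : flip bind (TM2.step (stmt D k₀ e ks))
        (some ⟨some none, ⟨q, true, none, false⟩, conf ((g :: w).map Sum.inl ++ i) b T⟩) =
        some ⟨some none, ⟨q, true, none, false⟩, conf (w.map Sum.inl ++ i) b
          (Function.update T k₀ (e g :: T k₀))⟩ := by
      simp [flip, stmt, conf]
    rw [this]
    refine (ih (Function.update T k₀ (e g :: T k₀))).trans ?_
    simp

/-- An instruction takes two steps, one to read it and one to perform it. After a failure the
machine does not stop: it carries on and only remembers the failure in `good`. The bound on the
stacks therefore holds in either case. -/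
theorem steps_exec (c : List (StackOp K A)) (T : K → List A) (q : Q) (good : Bool) :
    ∃ good' T', (good' = true ↔ good = true ∧ (StackOp.exec c T).isSome) ∧
      (∀ k, (T' k).length ≤ (T k).length + c.length) ∧
      steps D k₀ e ks (2 * c.length)
        (some ⟨some none, ⟨q, good, none, false⟩, conf (c.map Sum.inr) [] T⟩) =
      some ⟨some none, ⟨D.evalFrom q c, good', none, false⟩, conf [] [] T'⟩ := by
  induction c generalizing T q good with
  | nil => exact ⟨good, T, by simp [StackOp.exec], by simp, by simp [steps]⟩
  | cons o c ih =>
    have h : steps D k₀ e ks 2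
        (some ⟨some none, ⟨q, good, none, false⟩, conf ((o :: c).map Sum.inr) [] T⟩) =
        some ⟨some none, ⟨D.step q o, good && o.ok T, none, false⟩,
          conf (c.map Sum.inr) [] (o.apply T)⟩ := by
      cases o <;> simp [steps, flip, stmt, conf, execStmt, StackOp.ok, StackOp.apply]; congr
    obtain ⟨good', T', h₁, h₂, h₃⟩ := ih (o.apply T) (D.step q o) (good && o.ok T)
    refine ⟨good', T', ?_, fun k => ?_, ?_⟩
    · rw [h₁, StackOp.exec]
      cases o.ok T <;> simp
    · have := h₂ k
      have := o.length_apply_le T k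
      simp only [List.length_cons]
      omega
    · rw [List.length_cons, Nat.mul_succ, steps, Function.iterate_add_apply]
      rw [show (flip bind (TM2.step (stmt D k₀ e ks)))^[2] _ = _ from h]
      exact h₃

omit [DecidableEq A] [Inhabited A] in
theorem stepAux_popAll (l : List K) (hl : l.Nodup) (s) (v : State K A Γ Q) (i b)
    (T : K → List A) :
    TM2.stepAux (popAll l s) v (conf i b T) =
      TM2.stepAux s { v with seen := v.seen || l.any fun k => !(T k).isEmpty }
        (conf i b fun k => if k ∈ l then (T k).tail else T k) := by
  induction l generalizing v T with
  | nil => simp [popAll]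
  | cons k l ih =>
    have hk : ∀ j ∈ l, j ≠ k := fun j hj h => (List.nodup_cons.1 hl).1 (h ▸ hj)
    rw [popAll, TM2.stepAux, update_conf_work, ih (List.nodup_cons.1 hl).2]
    congr 1
    · simp only [conf, List.any_cons, Bool.or_assoc]
      congr 2
      congr 1
      · cases T k <;> simp
      · rw [Bool.eq_iff_iff, List.any_eq_true, List.any_eq_true]
        exact exists_congr fun j => and_congr_right fun hj => by
          rw [Function.update_of_ne (hk j hj)]
    · congr 1
      funext j
      by_cases h : j = k
      · subst h; simp [conf, (List.nodup_cons.1 hl).1]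
      · simp [h]

/-- A halting configuration must have empty work stacks and the initial internal state. One step
pops every stack once, so `m` rounds empty them, and one more round finds them all empty and writes
the answer. -/
theorem steps_clean (hks : ks.Nodup) (hmem : ∀ k, k ∈ ks) (m : ℕ) (T : K → List A)
    (hT : ∀ k, (T k).length ≤ m) (q : Q) (good seen : Bool) :
    ∃ n ≤ m + 1, steps D k₀ e ks n
        (some ⟨some (some none), ⟨q, good, none, seen⟩, conf [] [] T⟩) =
      some ⟨none, ⟨D.start, true, none, false⟩,
        conf [] [good && decide (q ∈ D.accept)] fun _ => []⟩ := by
  induction m generalizing T seen with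
  | zero =>
    have : T = fun _ => [] := funext fun k => List.length_eq_zero_iff.1 (by have := hT k; omega)
    subst this
    have : (ks.any fun _ => false) = false := by simp
    refine ⟨1, by simp, ?_⟩
    simp [steps, flip, stmt, stepAux_popAll _ hks, conf, this]
  | succ m ih =>
    by_cases hs : ks.any fun k => !(T k).isEmpty
    · obtain ⟨n, hn, h⟩ := ih (fun k => (T k).tail)
        (fun k => by have := hT k; simp only [List.length_tail]; omega) true
      refine ⟨n + 1, by omega, ?_⟩
      rw [steps, Function.iterate_succ_apply, ← h]
      congr 1
      simp [flip, stmt, stepAux_popAll _ hks, hs, hmem]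
    · have : T = fun _ => [] := funext fun k => by
        by_contra h
        exact hs (List.any_eq_true.2 ⟨k, hmem k, by simpa using h⟩)
      subst this
      have : (ks.any fun _ => false) = false := by simp
      refine ⟨1, by simp, ?_⟩
      simp [steps, flip, stmt, stepAux_popAll _ hks, conf, this]

end Executor

open Executor in
/-- A language is in `NP` if its words are those on which some sequence of instructions of
polynomial length that belongs to a given regular language can be executed. -/
theorem mem_NP_of_stackProgram {K A Γ : Type} [Fintype K] [DecidableEq K] [Fintype A]
    [DecidableEq A] [Fintype Γ] [Inhabited A] (L : Language Γ) (k₀ : K) (e : Γ → A)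
    (P : Language (StackOp K A)) (hP : P.IsRegular) (p : Polynomial ℕ)
    (hL : ∀ w, w ∈ L ↔ ∃ c : List (StackOp K A), c.length ≤ p.eval w.length ∧ c ∈ P ∧
      (StackOp.exec c (Function.update (fun _ => []) k₀ (w.map e).reverse)).isSome) :
    L ∈ NP Γ := by
  classical
  obtain ⟨Q, _, D, rfl⟩ := hP
  refine ⟨StackOp K A, inferInstance, fun x => decide (x.2 ∈ D.accepts ∧
    (StackOp.exec x.2 (Function.update (fun _ => []) k₀ (x.1.map e).reverse)).isSome), p, ⟨?_⟩,
    fun w => by simp [hL]⟩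
  refine { tm := machine D k₀ e Finset.univ.toList
           inputAlphabet := Equiv.refl _
           outputAlphabet := Equiv.refl _
           -- Reading `w`, executing `c`, leaving the reading loop and cleaning up take at most `|w|
           -- + 2|c| + 1 + (|w| + |c| + 1)` steps.
           time := Polynomial.C 4 * Polynomial.X + Polynomial.C 2
           outputsFun := fun x => Nonempty.some ?_ }
  obtain ⟨w, c⟩ := x
  have h₁ := steps_read_word D k₀ e Finset.univ.toList w (c.map Sum.inr) [] (fun _ => []) D.start
  obtain ⟨good, T, hg, hT, h₂⟩ := steps_exec D k₀ e Finset.univ.toList c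
    (Function.update (fun _ => []) k₀ (w.map e).reverse) D.start true
  obtain ⟨n, hn, h₃⟩ := steps_clean D k₀ e Finset.univ.toList (Finset.nodup_toList _)
    (fun k => by simp) (w.length + c.length) T
    (fun k => (hT k).trans (by
      by_cases h : k = k₀ <;> simp [h])) (D.evalFrom D.start c) good false
  refine ⟨⟨⟨n + (1 + (2 * c.length + w.length)), ?_⟩, ?_⟩⟩
  · rw [Function.iterate_add_apply, Function.iterate_add_apply, Function.iterate_add_apply]
    have h₀ : Turing.initList (machine D k₀ e Finset.univ.toList) (w.map Sum.inl ++ c.map Sum.inr) =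
        ⟨some none, ⟨D.start, true, none, false⟩,
          conf (w.map Sum.inl ++ c.map Sum.inr) [] fun _ => []⟩ := by
      rw [Turing.initList]
      congr 1
      funext k
      rcases k with _ | _ | k <;> rfl
    have h₄ : steps D k₀ e Finset.univ.toList 1
        (some ⟨some none, ⟨D.evalFrom D.start c, good, none, false⟩, conf [] [] T⟩) =
        some ⟨some (some none), ⟨D.evalFrom D.start c, good, none, false⟩, conf [] [] T⟩ := by
      simp [steps, flip, stmt, conf]
    have h₅ : (good && decide (D.evalFrom D.start c ∈ D.accept)) =
        decide (c ∈ D.accepts ∧ (StackOp.exec c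
          (Function.update (fun _ => []) k₀ (w.map e).reverse)).isSome) := by
      rw [Bool.eq_iff_iff]
      simp only [Bool.and_eq_true, hg, decide_eq_true_eq, true_and]
      exact and_comm
    rw [h₅] at h₃
    simp only [List.append_nil] at h₁
    have h₆ : Turing.haltList (machine D k₀ e Finset.univ.toList)
        [decide (c ∈ D.accepts ∧ (StackOp.exec c
          (Function.update (fun _ => []) k₀ (w.map e).reverse)).isSome)] =
        ⟨none, ⟨D.start, true, none, false⟩, conf [] [decide (c ∈ D.accepts ∧ (StackOp.exec c
          (Function.update (fun _ => []) k₀ (w.map e).reverse)).isSome)] fun _ => []⟩ := by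
      rw [Turing.haltList]
      congr 1
      funext k
      rcases k with _ | _ | k <;> rfl
    simp only [Computability.encodingProd, Computability.encodingList, id, Equiv.invFun_as_coe,
      Equiv.refl_symm, Equiv.coe_refl, List.map_id, Computability.encodeBool, List.pure_def,
      List.map_cons, List.map_nil,
      Option.map_some]
    refine Eq.trans ?_ (h₃.trans (congrArg some h₆.symm))
    refine congrArg _ (Eq.trans (congrArg _ ?_) h₄)
    refine Eq.trans (congrArg _ ?_) h₂
    exact (congrArg _ (congrArg some h₀)).trans h₁
  · simp [Computability.encodingProd, Computability.encodingList]
    omega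

end Arrival

/-! ### Calculus of program runs: sequence, choice, iteration, and scanning loops. -/

namespace Arrival

namespace StackOp

variable {K A : Type} [DecidableEq K] [DecidableEq A]

/-- The stacks `S'` can be reached from `S` by at most `t` instructions that match the regular
expression `P`. -/
def Runs (P : RegularExpression (StackOp K A)) (t : ℕ) (S S' : K → List A) : Prop :=
  ∃ c ∈ P.matches', c.length ≤ t ∧ exec c S = some S'

/-- A fixed sequence of instructions. -/
def word : List (StackOp K A) → RegularExpression (StackOp K A)
  | [] => 1
  | o :: c => .char o * word c

/-- A choice from a list of programs. -/
def anyOf : List (RegularExpression (StackOp K A)) → RegularExpression (StackOp K A)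
  | [] => 0
  | P :: l => P + anyOf l

/-- Repeatedly remove a symbol `a ∈ F` from all stacks in `src` and push `f a` on all stacks in
`tgt`. -/
def scan (F : List A) (src : List K) (f : A → A) (tgt : List K) :
    RegularExpression (StackOp K A) :=
  .star (anyOf (F.map fun a => word (src.map (pop · a) ++ tgt.map (push · (f a)))))

@[simp] theorem exec_nil {S S' : K → List A} : exec [] S = some S' ↔ S = S' := by simp [exec]

@[simp] theorem exec_push {k : K} {a : A} {c : List (StackOp K A)} {S : K → List A} :
    exec (.push k a :: c) S = exec c (Function.update S k (a :: S k)) := rfl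

@[simp] theorem exec_pop {k : K} {a : A} {c : List (StackOp K A)} {S S' : K → List A} :
    exec (.pop k a :: c) S = some S' ↔
      ∃ r, S k = a :: r ∧ exec c (Function.update S k r) = some S' := by
  rcases h : S k with _ | ⟨b, r⟩ <;> simp [exec, ok, apply, h, and_assoc]

@[simp] theorem exec_empty {k : K} {c : List (StackOp K A)} {S S' : K → List A} :
    exec (.empty k :: c) S = some S' ↔ S k = [] ∧ exec c S = some S' := by
  simp [exec, ok, apply]

variable {P Q : RegularExpression (StackOp K A)} {t t' : ℕ} {S S' S₁ : K → List A}

omit [DecidableEq K] [DecidableEq A] in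
theorem matches'_word (c : List (StackOp K A)) : (word c).matches' = {c} := by
  induction c with
  | nil => rfl
  | cons o c ih =>
    rw [word, RegularExpression.matches'_mul, ih, RegularExpression.matches'_char]
    exact Set.image2_singleton

theorem runs_word {c : List (StackOp K A)} :
    Runs (word c) t S S' ↔ c.length ≤ t ∧ exec c S = some S' := by
  rw [Runs, matches'_word]
  exact ⟨fun ⟨_, h, h'⟩ => by rw [Set.mem_singleton_iff.1 h] at h'; exact h',
    fun h => ⟨c, rfl, h⟩⟩

theorem Runs.mono (h : Runs P t S S') (ht : t ≤ t') : Runs P t' S S' :=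
  let ⟨c, hc, hl, he⟩ := h
  ⟨c, hc, hl.trans ht, he⟩

theorem Runs.mul (h : Runs P t S S₁) (h' : Runs Q t' S₁ S') : Runs (P * Q) (t + t') S S' := by
  obtain ⟨c, hc, hl, he⟩ := h
  obtain ⟨c', hc', hl', he'⟩ := h'
  refine ⟨c ++ c', ?_, by simp; omega, by simp [exec_append, he, he']⟩
  rw [RegularExpression.matches'_mul]
  exact Language.append_mem_mul hc hc'

theorem runs_mul (h : Runs (P * Q) t S S') : ∃ S₁, Runs P t S S₁ ∧ Runs Q t S₁ S' := by
  obtain ⟨c, hc, hl, he⟩ := h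
  rw [RegularExpression.matches'_mul] at hc
  obtain ⟨a, ha, b, hb, rfl⟩ := Language.mem_mul.1 hc
  rw [exec_append, Option.bind_eq_some_iff] at he
  obtain ⟨S₁, h₁, h₂⟩ := he
  simp only [List.length_append] at hl
  exact ⟨S₁, ⟨a, ha, by omega, h₁⟩, ⟨b, hb, by omega, h₂⟩⟩

theorem runs_add : Runs (P + Q) t S S' ↔ Runs P t S S' ∨ Runs Q t S S' := by
  simp only [Runs, RegularExpression.matches'_add, Language.mem_add, or_and_right, exists_or]

theorem runs_anyOf {l : List (RegularExpression (StackOp K A))} :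
    Runs (anyOf l) t S S' ↔ ∃ P ∈ l, Runs P t S S' := by
  induction l with
  | nil => simp [anyOf, Runs]
  | cons P l ih => simp [anyOf, runs_add, ih]

theorem Runs.star_refl : Runs P.star t S S :=
  ⟨[], by rw [RegularExpression.matches'_star]; exact Language.nil_mem_kstar _, by simp, rfl⟩

theorem Runs.star_head (h : Runs P t S S₁) (h' : Runs P.star t' S₁ S') :
    Runs P.star (t + t') S S' := by
  obtain ⟨c, hc, hl, he⟩ := h.mul h'
  refine ⟨c, ?_, hl, he⟩
  rw [RegularExpression.matches'_mul, RegularExpression.matches'_star] at hc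
  rw [RegularExpression.matches'_star, ← Language.one_add_self_mul_kstar_eq_kstar]
  exact Or.inr hc

theorem Runs.star_single (h : Runs P t S S') : Runs P.star t S S' := by
  simpa using h.star_head (.star_refl (t := 0))

theorem Runs.star_trans (h : Runs P.star t S S₁) (h' : Runs P.star t' S₁ S') :
    Runs P.star (t + t') S S' := by
  obtain ⟨c, hc, hl, he⟩ := h.mul h'
  refine ⟨c, ?_, hl, he⟩
  rw [RegularExpression.matches'_mul, RegularExpression.matches'_star] at hc
  rwa [RegularExpression.matches'_star, ← kstar_mul_kstar]

/-- Meant for soundness, where time is irrelevant: each iteration is simply granted the time of the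
whole loop. -/
theorem runs_star (h : Runs P.star t S S') : Relation.ReflTransGen (Runs P t) S S' := by
  obtain ⟨c, hc, hl, he⟩ := h
  rw [RegularExpression.matches'_star] at hc
  obtain ⟨l, rfl, h⟩ := Language.mem_kstar.1 hc
  clear hc
  induction l generalizing S with
  | nil => obtain rfl : S = S' := by simpa [exec] using he
           exact .refl
  | cons a l ih =>
    rw [List.flatten_cons, exec_append, Option.bind_eq_some_iff] at he
    obtain ⟨S₁, h₁, h₂⟩ := he
    simp only [List.flatten_cons, List.length_append] at hl
    exact .head ⟨a, h a (by simp), by omega, h₁⟩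
      (ih (fun y hy => h y (List.mem_cons_of_mem _ hy)) (by omega) h₂)

/-- Time bounds space. This later bounds the ledger by the time spent on filling it. -/
theorem Runs.length_le (h : Runs P t S S') (k : K) : (S' k).length ≤ (S k).length + t := by
  obtain ⟨c, -, hl, he⟩ := h
  refine le_trans ?_ (Nat.add_le_add_left hl _)
  clear hl
  induction c generalizing S with
  | nil => obtain rfl : S = S' := by simpa [exec] using he
           simp
  | cons o c ih =>
    rw [exec] at he
    split_ifs at he
    have := ih he
    have := o.length_apply_le S k
    simp only [List.length_cons]
    omega

/-- The effect of the loop `scan` when it runs through the symbols of `x`. -/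
structure Scan (src : List K) (f : A → A) (tgt : List K) (x : List A)
    (S S' : K → List A) : Prop where
  source : ∀ k ∈ src, S k = x ++ S' k
  target : ∀ k ∈ tgt, S' k = (x.map f).reverse ++ S k
  frame : ∀ k, k ∉ src → k ∉ tgt → S' k = S k

theorem exec_push_iff (tgt : List K) (a : A) (ht : tgt.Nodup) (S S' : K → List A) :
    exec (tgt.map (push · a)) S = some S' ↔
      (∀ k ∈ tgt, S' k = a :: S k) ∧ ∀ k ∉ tgt, S' k = S k := by
  induction tgt generalizing S with
  | nil => simp [exec, funext_iff, eq_comm]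
  | cons j l ih =>
    simp only [List.map_cons, exec, ok, apply, if_true, ih (List.nodup_cons.1 ht).2]
    have := (List.nodup_cons.1 ht).1
    constructor
    · rintro ⟨h₁, h₂⟩
      constructor <;> intro k hk
      · rcases eq_or_ne k j with rfl | hkj
        · simp [h₂ k this]
        · rw [h₁ k (by simpa [hkj] using hk), Function.update_of_ne hkj]
      · simp only [List.mem_cons, not_or] at hk
        rw [h₂ k hk.2, Function.update_of_ne hk.1]
    · rintro ⟨h₁, h₂⟩
      constructor <;> intro k hk
      · rw [h₁ k (by simp [hk]), Function.update_of_ne (by rintro rfl; exact this hk)]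
      · rcases eq_or_ne k j with rfl | hkj
        · simp [h₁ k]
        · rw [h₂ k (by simp [hk, hkj]), Function.update_of_ne hkj]

theorem exec_pop_iff (src : List K) (a : A) (hs : src.Nodup) (S S' : K → List A) :
    exec (src.map (pop · a)) S = some S' ↔
      (∀ k ∈ src, S k = a :: S' k) ∧ ∀ k ∉ src, S' k = S k := by
  induction src generalizing S with
  | nil => simp [exec, funext_iff, eq_comm]
  | cons j l ih =>
    simp only [List.map_cons, exec, ok, apply, Option.ite_none_right_eq_some, decide_eq_true_eq,
      ih (List.nodup_cons.1 hs).2]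
    have := (List.nodup_cons.1 hs).1
    constructor
    · rintro ⟨h, h₁, h₂⟩
      constructor <;> intro k hk
      · rcases eq_or_ne k j with rfl | hkj
        · rw [h₂ k this, Function.update_self]
          exact List.eq_cons_of_mem_head? h
        · rw [← h₁ k (by simpa [hkj] using hk), Function.update_of_ne hkj]
      · simp only [List.mem_cons, not_or] at hk
        rw [h₂ k hk.2, Function.update_of_ne hk.1]
    · rintro ⟨h₁, h₂⟩
      refine ⟨by simp [h₁ j], ?_, ?_⟩ <;> intro k hk
      · rw [← h₁ k (by simp [hk]), Function.update_of_ne (by rintro rfl; exact this hk)]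
      · rcases eq_or_ne k j with rfl | hkj
        · simp [h₁ k]
        · rw [h₂ k (by simp [hk, hkj]), Function.update_of_ne hkj]

theorem exec_pop_push_iff {src tgt : List K} (h : (src ++ tgt).Nodup) (a b : A)
    (S S' : K → List A) :
    exec (src.map (pop · a) ++ tgt.map (push · b)) S = some S' ↔
      (∀ k ∈ src, S k = a :: S' k) ∧ (∀ k ∈ tgt, S' k = b :: S k) ∧
        ∀ k, k ∉ src → k ∉ tgt → S' k = S k := by
  obtain ⟨hs, ht, hd⟩ := List.nodup_append'.1 h
  rw [exec_append, Option.bind_eq_some_iff]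
  simp only [exec_pop_iff _ _ hs, exec_push_iff _ _ ht]
  constructor
  · rintro ⟨T, ⟨h₁, h₂⟩, h₃, h₄⟩
    refine ⟨fun k hk => ?_, fun k hk => ?_, fun k hk hk' => ?_⟩
    · rw [h₁ k hk, h₄ k (hd hk)]
    · rw [h₃ k hk, h₂ k fun h => hd h hk]
    · rw [h₄ k hk', h₂ k hk]
  · rintro ⟨h₁, h₂, h₃⟩
    -- The intermediate state: the sources are already popped, the targets not yet pushed.
    refine ⟨fun k => if k ∈ src then S' k else S k, ⟨fun k hk => ?_, fun k hk => ?_⟩,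
      fun k hk => ?_, fun k hk => ?_⟩
    · simp [hk, h₁ k hk]
    · simp [hk]
    · simp [show k ∉ src from fun h => hd h hk, h₂ k hk]
    · by_cases hks : k ∈ src
      · simp [hks]
      · simp [hks, h₃ k hks hk]

/-- Nothing forces a scan to go as far as it can, so `x` is an arbitrary common prefix with symbols
in `F`. Programs enforce completeness by testing, right after the loop, for emptiness or for a
delimiter. -/
theorem runs_scan {F : List A} {src tgt : List K} {f : A → A} (hn : (src ++ tgt).Nodup)
    (h : Runs (scan F src f tgt) t S S') : ∃ x, (∀ a ∈ x, a ∈ F) ∧ Scan src f tgt x S S' := by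
  replace h := runs_star h
  induction h using Relation.ReflTransGen.head_induction_on with
  | refl => exact ⟨[], by simp, by simp, by simp, by simp⟩
  | @head S S₁ h _ ih =>
    obtain ⟨x, hx, h₁, h₂, h₃⟩ := ih
    obtain ⟨P, hP, h⟩ := runs_anyOf.1 h
    obtain ⟨a, ha, rfl⟩ := List.mem_map.1 hP
    obtain ⟨h₄, h₅, h₆⟩ := (exec_pop_push_iff hn _ _ _ _).1 (runs_word.1 h).2
    refine ⟨a :: x, by simpa [ha] using hx, fun k hk => ?_, fun k hk => ?_, fun k hk hk' => ?_⟩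
    · rw [h₄ k hk, h₁ k hk, List.cons_append]
    · rw [h₂ k hk, h₅ k hk]; simp
    · rw [h₃ k hk hk', h₆ k hk hk']

theorem Scan.runs {F : List A} {src tgt : List K} {f : A → A} {x : List A}
    (h : Scan src f tgt x S S') (hn : (src ++ tgt).Nodup) (hx : ∀ a ∈ x, a ∈ F) :
    Runs (scan F src f tgt) (x.length * (src.length + tgt.length)) S S' := by
  induction x generalizing S with
  | nil =>
    obtain rfl : S' = S := funext fun k => by
      by_cases hs : k ∈ src
      · simpa using (h.source k hs).symm
      by_cases ht : k ∈ tgt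
      · simpa using h.target k ht
      exact h.frame k hs ht
    exact .star_refl
  | cons a x ih =>
    simp only [List.mem_cons, forall_eq_or_imp] at hx
    obtain ⟨-, -, hd⟩ := List.nodup_append'.1 hn
    let S₁ : K → List A := fun k =>
      if k ∈ src then (S k).tail else if k ∈ tgt then f a :: S k else S k
    have h₁ : Runs (anyOf (F.map fun a => word (src.map (pop · a) ++ tgt.map (push · (f a)))))
        (src.length + tgt.length) S S₁ := by
      refine runs_anyOf.2 ⟨_, List.mem_map.2 ⟨a, hx.1, rfl⟩, runs_word.2 ⟨by simp, ?_⟩⟩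
      refine (exec_pop_push_iff hn _ _ _ _).2 ⟨fun k hk => ?_, fun k hk => ?_, fun k hk hk' => ?_⟩
      · simp [S₁, hk, h.source k hk]
      · simp [S₁, hk, show k ∉ src from fun h => hd h hk]
      · simp [S₁, hk, hk']
    rw [List.length_cons, Nat.add_mul, Nat.one_mul, Nat.add_comm]
    refine h₁.star_head (ih ⟨fun k hk => ?_, fun k hk => ?_, fun k hk hk' => ?_⟩ hx.2)
    · simp [S₁, hk, h.source k hk]
    · have := h.target k hk
      simpa [S₁, hk, show k ∉ src from fun h => hd h hk] using this
    · simp [S₁, hk, hk', h.frame k hk hk']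

end StackOp

end Arrival

namespace Arrival

/-! ### The verifier for ARRIVAL as a stack program -/

/-- The symbols on the stacks of the verifier. -/
inductive Sym
  | bit (b : Bool)
  | sep
  | tick
  | star
  | sgn (s : Bool)
  deriving DecidableEq, Fintype

/-- The stacks of the verifier: the reversed input, the input, the number of the current vertex, two
numbers, a temporary stack, and three stacks of signed tokens. -/
inductive Reg
  | rev
  | inp
  | ctr
  | fst
  | snd
  | tmp
  | ledger (i : Fin 3)
  deriving DecidableEq, Fintype

namespace Verifier

open StackOp Function

/-- The symbols that occur in binary numbers. -/
def bitSyms : List Sym := [.bit false, .bit true]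

/-- The symbols that occur in tokens. -/
def tokenSyms : List Sym := [.bit false, .bit true, .tick, .star]

/-- The word of a binary number. -/
def name (x : List Bool) : List Sym := x.map .bit

theorem mem_bitSyms_iff {x : List Sym} : (∀ a ∈ x, a ∈ bitSyms) ↔ ∃ y, x = name y := by
  induction x with
  | nil => exact ⟨fun _ => ⟨[], rfl⟩, by simp⟩
  | cons a x ih =>
    rw [List.forall_mem_cons, ih]
    constructor
    · rintro ⟨h, y, rfl⟩
      simp only [bitSyms, List.mem_cons, List.not_mem_nil, or_false] at h
      rcases h with rfl | rfl
      exacts [⟨false :: y, rfl⟩, ⟨true :: y, rfl⟩]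
    · rintro ⟨_ | ⟨b, y⟩, h⟩ <;> simp only [name, List.map_nil, List.map_cons, reduceCtorEq,
        List.cons.injEq] at h
      exact ⟨by cases b <;> simp [h.1, bitSyms], y, h.2⟩

theorem mem_bitSyms_of_mem_name (x : List Bool) : ∀ a ∈ name x, a ∈ bitSyms :=
  mem_bitSyms_iff.2 ⟨x, rfl⟩

@[simp] theorem length_name (x : List Bool) : (name x).length = x.length := by simp [name]

theorem name_injective : Injective name :=
  List.map_injective_iff.2 fun _ _ h => Sym.bit.inj h

theorem name_reverse (x : List Bool) : (name x).reverse = name x.reverse := by simp [name]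

/-- Replace the number on the stack `X` by the next number of the input. -/
def readNum (X : Reg) : RegularExpression (StackOp Reg Sym) :=
  scan bitSyms [X] id [] * word [.empty X] * scan bitSyms [.inp] id [.tmp] *
    word [.pop .inp .sep] * scan bitSyms [.tmp] id [X] * word [.empty .tmp]

/-- Copy the number on the stack `X` to the stack `Y`. -/
def copyNum (X Y : Reg) : RegularExpression (StackOp Reg Sym) :=
  scan bitSyms [X] id [.tmp] * word [.empty X] * scan bitSyms [.tmp] id [Y, X] *
    word [.empty .tmp]

/-- Increment the number of the current vertex. -/
def incr : RegularExpression (StackOp Reg Sym) :=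
  scan [.bit true] [.ctr] (fun _ => .bit false) [.tmp] *
    (word [.empty .ctr] + word [.pop .ctr (.bit false)]) * word [.push .ctr (.bit true)] *
    scan [.bit false] [.tmp] id [.ctr] * word [.empty .tmp]

variable {S S' : Reg → List Sym} {t : ℕ}

/-- The two emptiness tests force both scans to the end, and the detour over `tmp` reverses the
number twice. -/
theorem copyNum_sound {X Y : Reg} (hX : X ≠ .tmp) (hY : Y ≠ .tmp) (hXY : X ≠ Y)
    (hS : S .tmp = []) (h : Runs (copyNum X Y) t S S') :
    ∃ x, S X = name x ∧ S' = update S Y (name x ++ S Y) := by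
  obtain ⟨S₃, h, h₄⟩ := runs_mul h
  obtain ⟨S₂, h, h₃⟩ := runs_mul h
  obtain ⟨S₁, h₁, h₂⟩ := runs_mul h
  obtain ⟨x, hx, h₁⟩ := runs_scan (by simpa using hX) h₁
  obtain ⟨y, hy, h₃⟩ := runs_scan (by simp [hX.symm, hY.symm, hXY.symm]) h₃
  obtain ⟨x, rfl⟩ := mem_bitSyms_iff.1 hx
  simp only [runs_word, exec_nil, exec_empty] at h₂ h₄
  obtain ⟨-, h₂, rfl⟩ := h₂
  obtain ⟨-, h₄, rfl⟩ := h₄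
  have e₁ := h₁.source X (by simp)
  have e₂ := h₁.target .tmp (by simp)
  have e₃ := h₃.source .tmp (by simp)
  have e₄ := h₃.target X (by simp)
  have e₅ := h₃.target Y (by simp)
  have e₆ := h₁.frame Y (by simp [hXY.symm]) (by simp [hY])
  have hy' : y = (name x).reverse := by simp_all
  subst hy'
  refine ⟨x, by simp_all, funext fun k => ?_⟩
  rcases eq_or_ne k Y with rfl | hkY
  · simp_all
  rcases eq_or_ne k X with rfl | hkX
  · simp_all
  rcases eq_or_ne k .tmp with rfl | hk
  · simp_all
  rw [update_of_ne hkY, h₃.frame k (by simp [hk]) (by simp [hkX, hkY]),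
    h₁.frame k (by simp [hkX]) (by simp [hk])]

theorem copyNum_complete {X Y : Reg} (hX : X ≠ .tmp) (hY : Y ≠ .tmp) (hXY : X ≠ Y)
    (hS : S .tmp = []) {x : List Bool} (hx : S X = name x) :
    Runs (copyNum X Y) (5 * x.length + 2) S (update S Y (name x ++ S Y)) := by
  have h₁ : Scan [X] id [.tmp] (name x) S (update (update S X []) .tmp (name x).reverse) :=
    ⟨by simp [hX, hx], by simp [hS], by simp +contextual⟩
  have h₂ : Scan [.tmp] id [Y, X] (name x).reverse
      (update (update S X []) .tmp (name x).reverse) (update S Y (name x ++ S Y)) := by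
    refine ⟨by simp [hY.symm, hS], by simp [hX, hY, hXY, hXY.symm, hx], by simp +contextual⟩
  refine ((((h₁.runs (by simpa using hX) (mem_bitSyms_of_mem_name x)).mul
    (runs_word.2 ⟨le_rfl, ?_⟩)).mul (h₂.runs (by simp [hX.symm, hY.symm, hXY.symm]) ?_)).mul
      (runs_word.2 ⟨le_rfl, ?_⟩)).mono ?_
  · simp [hX]
  · rw [name_reverse]; exact mem_bitSyms_of_mem_name _
  · simp [hY.symm, hS]
  · simp; omega

/-- The scan of the input must stop exactly at a separator, since the next instruction pops one. -/
theorem readNum_sound {X : Reg} (hX : X ≠ .tmp) (hX' : X ≠ .inp)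
    (hS : S .tmp = []) (h : Runs (readNum X) t S S') :
    ∃ x, S .inp = name x ++ .sep :: S' .inp ∧
      S' = update (update S .inp (S' .inp)) X (name x) := by
  obtain ⟨S₅, h, h₆⟩ := runs_mul h
  obtain ⟨S₄, h, h₅⟩ := runs_mul h
  obtain ⟨S₃, h, h₄⟩ := runs_mul h
  obtain ⟨S₂, h, h₃⟩ := runs_mul h
  obtain ⟨S₁, h₁, h₂⟩ := runs_mul h
  obtain ⟨z, hz, h₁⟩ := runs_scan (by simp) h₁
  obtain ⟨x, hx, h₃⟩ := runs_scan (by simp) h₃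
  obtain ⟨y, hy, h₅⟩ := runs_scan (by simpa using hX.symm) h₅
  obtain ⟨x, rfl⟩ := mem_bitSyms_iff.1 hx
  simp only [runs_word, exec_nil, exec_empty, exec_pop] at h₂ h₄ h₆
  obtain ⟨-, h₂, rfl⟩ := h₂
  obtain ⟨-, r, h₄, rfl⟩ := h₄
  obtain ⟨-, h₆, rfl⟩ := h₆
  have e₁ := h₃.source .inp (by simp)
  have e₂ := h₃.target .tmp (by simp)
  have e₃ := h₅.source .tmp (by simp)
  have e₄ := h₅.target X (by simp)
  have e₅ := h₅.frame .inp (by simp) (by simp [hX'.symm])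
  have e₆ := h₁.frame .inp (by simp [hX'.symm]) (by simp)
  have e₇ := h₁.frame .tmp (by simp [hX.symm]) (by simp)
  have e₈ := h₃.frame X (by simp [hX']) (by simp [hX])
  have hy' : y = (name x).reverse := by simp_all
  subst hy'
  refine ⟨x, by simp_all, funext fun k => ?_⟩
  rcases eq_or_ne k X with rfl | hkX
  · simp_all
  rcases eq_or_ne k .inp with rfl | hki
  · simp_all
  rcases eq_or_ne k .tmp with rfl | hk
  · simp_all
  rw [update_of_ne hkX, update_of_ne hki, h₅.frame k (by simp [hk]) (by simp [hkX]),
    update_of_ne hki, h₃.frame k (by simp [hki]) (by simp [hk]), h₁.frame k (by simp [hkX])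
    (by simp)]

theorem readNum_complete {X : Reg} (hX : X ≠ .tmp) (hX' : X ≠ .inp)
    (hS : S .tmp = []) {x z : List Bool} {r : List Sym} (hz : S X = name z)
    (hx : S .inp = name x ++ .sep :: r) :
    Runs (readNum X) (z.length + 4 * x.length + 3) S
      (update (update S .inp r) X (name x)) := by
  have h₁ : Scan [X] id [] (name z) S (update S X []) :=
    ⟨by simp [hz], by simp, by simp +contextual⟩
  have h₂ : Scan [.inp] id [.tmp] (name x) (update S X [])
      (update (update (update S X []) .inp (.sep :: r)) .tmp (name x).reverse) :=
    ⟨by simp [hX'.symm, hx], by simp [hS, hX.symm], by simp +contextual⟩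
  have h₃ : Scan [.tmp] id [X] (name x).reverse
      (update (update (update S X []) .inp r) .tmp (name x).reverse)
      (update (update S .inp r) X (name x)) := by
    refine ⟨by simp [hX.symm, hS], by simp [hX, hX'], ?_⟩
    intro k hk hkX
    simp only [List.mem_singleton] at hk hkX
    simp [update_apply, hk, hkX]
  refine ((((((h₁.runs (by simp) (mem_bitSyms_of_mem_name z)).mul
    (runs_word.2 ⟨le_rfl, ?_⟩)).mul (h₂.runs (by simp) (mem_bitSyms_of_mem_name x))).mul
      (runs_word.2 ⟨le_rfl, ?_⟩)).mul (h₃.runs (by simpa using hX.symm) ?_)).mul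
      (runs_word.2 ⟨le_rfl, ?_⟩)).mono ?_
  · simp
  · refine exec_pop.2 ⟨r, by simp, exec_nil.2 (funext fun k => ?_)⟩
    simp only [update_apply]
    split_ifs <;> simp_all
  · rw [name_reverse]; exact mem_bitSyms_of_mem_name _
  · simp [hX.symm, hS]
  · simp; omega

/-- The successor of a binary number, least significant bit first. -/
def succBits : List Bool → List Bool
  | [] => [true]
  | false :: l => true :: l
  | true :: l => false :: succBits l

theorem bits_succ (n : ℕ) : (n + 1).bits = succBits n.bits := by
  induction n using Nat.binaryRec' with
  | zero => simp [succBits]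
  | bit b n h ih =>
    rw [Nat.bits_append_bit n b h]
    cases b with
    | false => rw [show Nat.bit false n + 1 = Nat.bit true n by simp [Nat.bit],
        Nat.bits_append_bit n true (by simp), succBits]
    | true => rw [show Nat.bit true n + 1 = Nat.bit false (n + 1) by simp [Nat.bit]; ring,
        Nat.bits_append_bit _ false (by simp), succBits, ih]

/-- The initial block of ones is what the carry runs through. -/
theorem exists_eq_replicate_true (x : List Bool) :
    ∃ j, x = List.replicate j true ∨ ∃ r, x = List.replicate j true ++ false :: r := by
  induction x with
  | nil => exact ⟨0, Or.inl rfl⟩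
  | cons b x ih =>
    cases b with
    | false => exact ⟨0, Or.inr ⟨x, rfl⟩⟩
    | true =>
      obtain ⟨j, rfl | ⟨r, rfl⟩⟩ := ih
      · exact ⟨j + 1, Or.inl rfl⟩
      · exact ⟨j + 1, Or.inr ⟨r, rfl⟩⟩

theorem succBits_replicate (j : ℕ) :
    succBits (List.replicate j true) = List.replicate j false ++ [true] := by
  induction j with
  | zero => rfl
  | succ j ih => simp [List.replicate_succ, succBits, ih]

theorem succBits_replicate_append (j : ℕ) (r : List Bool) :
    succBits (List.replicate j true ++ false :: r) = List.replicate j false ++ true :: r := by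
  induction j with
  | zero => rfl
  | succ j ih => simp [List.replicate_succ, succBits, ih]

/-- The carry turns leading ones into zeros. It cannot stop early, because the next instruction
requires either the end of the number or a zero, and that position becomes a one. -/
theorem incr_sound (hS : S .tmp = []) {x : List Bool} (hx : S .ctr = name x)
    (h : Runs incr t S S') : S' = update S .ctr (name (succBits x)) := by
  obtain ⟨S₄, h, h₅⟩ := runs_mul h
  obtain ⟨S₃, h, h₄⟩ := runs_mul h
  obtain ⟨S₂, h, h₃⟩ := runs_mul h
  obtain ⟨S₁, h₁, h₂⟩ := runs_mul h
  obtain ⟨y, hy, h₁⟩ := runs_scan (by simp) h₁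
  obtain ⟨z, hz, h₄⟩ := runs_scan (by simp) h₄
  rw [runs_add] at h₂
  simp only [runs_word, exec_nil, exec_empty, exec_pop, exec_push] at h₂ h₃ h₅
  obtain ⟨-, rfl⟩ := h₃
  obtain ⟨-, h₅, rfl⟩ := h₅
  obtain ⟨j, rfl⟩ : ∃ j, y = List.replicate j (.bit true) :=
    ⟨y.length, List.eq_replicate_iff.2 ⟨rfl, by simpa using hy⟩⟩
  have e₁ := h₁.source .ctr (by simp)
  have e₂ := h₁.target .tmp (by simp)
  have e₃ := h₄.source .tmp (by simp)
  have e₄ := h₄.target .ctr (by simp)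
  simp only [hS, List.map_replicate, List.reverse_replicate, List.append_nil] at e₂
  have hfr : ∀ k, k ≠ .ctr → k ≠ .tmp → S₄ k = S₂ k := fun k hk hk' => by
    rw [h₄.frame k (by simp [hk']) (by simp [hk]), update_of_ne hk]
  have hz' : z = S₂ .tmp := by simp_all
  rcases h₂ with ⟨-, h₂, rfl⟩ | ⟨-, r', h₂, rfl⟩
  · obtain rfl : x = List.replicate j true := by
      apply name_injective
      rw [← hx, e₁, h₂]
      simp [name]
    funext k
    rcases eq_or_ne k .ctr with rfl | hk
    · rw [e₄, hz', e₂, update_self, update_self, h₂, succBits_replicate]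
      simp [name]
    rcases eq_or_ne k .tmp with rfl | hk'
    · simp_all
    · rw [hfr k hk hk', update_of_ne hk, h₁.frame k (by simp [hk]) (by simp [hk'])]
  · obtain ⟨r, rfl, hr⟩ : ∃ r, x = List.replicate j true ++ false :: r ∧
        r' = name r := by
      rw [h₂, hx] at e₁
      obtain ⟨u, v, rfl, hu, hv⟩ := List.map_eq_append_iff.1 e₁
      obtain ⟨b, v, rfl, hb, hv⟩ := List.map_eq_cons_iff.1 hv
      refine ⟨v, ?_, hv.symm⟩
      rw [Sym.bit.inj hb]
      congr 1
      apply name_injective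
      rw [name, hu]
      simp [name]
    funext k
    rcases eq_or_ne k .ctr with rfl | hk
    · rw [update_of_ne (by simp)] at hz'
      rw [e₄, hz', e₂, update_self, update_self, update_self, hr, succBits_replicate_append]
      simp [name]
    rcases eq_or_ne k .tmp with rfl | hk'
    · simp_all
    · rw [hfr k hk hk', update_of_ne hk, update_of_ne hk,
        h₁.frame k (by simp [hk]) (by simp [hk'])]

theorem incr_complete (hS : S .tmp = []) {x : List Bool} (hx : S .ctr = name x) :
    Runs incr (4 * x.length + 3) S (update S .ctr (name (succBits x))) := by
  obtain ⟨j, h⟩ := exists_eq_replicate_true x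
  obtain ⟨r, r', hj, h₀, h₁, h₂⟩ : ∃ r r', j ≤ x.length ∧
      S .ctr = List.replicate j (.bit true) ++ r ∧
      (r = [] ∧ r' = [] ∨ r = .bit false :: r') ∧
      name (succBits x) = List.replicate j (.bit false) ++ .bit true :: r' := by
    rcases h with rfl | ⟨r, rfl⟩
    · exact ⟨[], [], by simp, by simp [hx, name], Or.inl ⟨rfl, rfl⟩,
        by simp [succBits_replicate, name]⟩
    · exact ⟨.bit false :: name r, name r, by simp, by simp [hx, name], Or.inr rfl,
        by simp [succBits_replicate_append, name]⟩
  have s₁ : Scan [.ctr] (fun _ => .bit false) [.tmp] (List.replicate j (.bit true)) S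
      (update (update S .ctr r) .tmp (List.replicate j (.bit false))) :=
    ⟨by simp [h₀], by simp [hS], by simp +contextual⟩
  have s₂ : Scan [.tmp] id [.ctr] (List.replicate j (.bit false))
      (update (update S .ctr (.bit true :: r')) .tmp (List.replicate j (.bit false)))
      (update S .ctr (name (succBits x))) :=
    ⟨by simp [hS], by simp [h₂], by simp +contextual⟩
  have s₃ : Runs (word [.empty .ctr] + word [.pop .ctr (.bit false)]) 1
      (update (update S .ctr r) .tmp (List.replicate j (.bit false)))
      (update (update S .ctr r') .tmp (List.replicate j (.bit false))) := by
    rw [runs_add, runs_word, runs_word]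
    rcases h₁ with ⟨rfl, rfl⟩ | rfl
    · exact Or.inl ⟨by simp, by simp⟩
    · refine Or.inr ⟨by simp, ?_⟩
      refine exec_pop.2 ⟨r', by simp, exec_nil.2 (funext fun k => ?_)⟩
      simp only [update_apply]
      split_ifs <;> simp_all
  refine (((((s₁.runs (by simp) (by simp)).mul s₃).mul (runs_word.2 ⟨le_rfl, ?_⟩)).mul
      (s₂.runs (by simp) (by simp))).mul (runs_word.2 ⟨le_rfl, ?_⟩)).mono ?_
  · rw [exec_push, exec_nil]
    funext k
    simp only [update_apply]
    split_ifs <;> simp_all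
  · simp [hS]
  · simp; omega

end Verifier

end Arrival

/-! ### The ledger of signed tokens and its value. -/

namespace Arrival

namespace Verifier

open StackOp Function

/-- A token: a word and a sign. The words `x` and `tick :: x` stand for one and two units at the
same place. -/
abbrev Token := List Sym × Bool

/-- The stack that contains a list of tokens. -/
def enc (T : List Token) : List Sym := T.flatMap fun p => p.1 ++ [.sgn p.2]

/-- The sign of a token as an integer. -/
def sign (s : Bool) : ℤ := if s then 1 else -1

/-- Valuations of words that double with each tick. -/
def IsVal (v : List Sym → ℤ) : Prop := ∀ x, v (.tick :: x) = 2 * v x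

/-- The total value of a list of tokens. -/
def total (v : List Sym → ℤ) (T : List Token) : ℤ := (T.map fun p => sign p.2 * v p.1).sum

/-- The ledger stacks contain the lists of tokens `T`. -/
structure Ledger (S : Reg → List Sym) (T : Fin 3 → List Token) : Prop where
  tmp : S .tmp = []
  stack : ∀ i, S (.ledger i) = enc (T i)
  valid : ∀ i, ∀ p ∈ T i, ∀ a ∈ p.1, a ∈ tokenSyms

/-- The tokens on the ledger have the total value `φ v` under each valuation `v`. -/
def HasValue (S : Reg → List Sym) (φ : (List Sym → ℤ) → ℤ) : Prop :=
  ∃ T, Ledger S T ∧ ∀ v, IsVal v → ∑ i, total v (T i) = φ v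

/-- A computation that changes only the ledger, and adds `ψ` to its value. -/
structure Emits (ψ : (List Sym → ℤ) → ℤ) (S S' : Reg → List Sym) : Prop where
  frame : ∀ k, (∀ i, k ≠ .ledger i) → S' k = S k
  value : ∀ φ, HasValue S φ → HasValue S' fun v => φ v + ψ v

/-- Put a token on the stack `i` of the ledger. -/
def addToken (i : Fin 3) (x : List Sym) (s : Bool) (S : Reg → List Sym) : Reg → List Sym :=
  update S (.ledger i) (x ++ .sgn s :: S (.ledger i))

/-- Put a token whose word consists of a prefix and the number on the stack `X` on the ledger. -/
def emit (X : Reg) (i : Fin 3) (s : Bool) (pre : List Sym) : RegularExpression (StackOp Reg Sym) :=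
  word [.push (.ledger i) (.sgn s)] * copyNum X (.ledger i) * word (pre.map (.push (.ledger i)))

/-- Move `2 ^ (j + 1)` trains from the current vertex to its successors. -/
def fire : RegularExpression (StackOp Reg Sym) :=
  word [.push (.ledger 0) (.sgn false), .push (.ledger 1) (.sgn true),
      .push (.ledger 2) (.sgn true)] *
    copyNum .ctr (.ledger 0) * copyNum .fst (.ledger 1) * copyNum .snd (.ledger 2) *
    scan [.tick] [] id [.ledger 0, .ledger 1, .ledger 2] * word [.push (.ledger 0) .tick]

variable {S S' S₁ : Reg → List Sym} {t : ℕ} {φ ψ ψ' : (List Sym → ℤ) → ℤ} {v : List Sym → ℤ}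

theorem IsVal.replicate (hv : IsVal v) (j : ℕ) (x : List Sym) :
    v (List.replicate j .tick ++ x) = 2 ^ j * v x := by
  induction j with
  | zero => simp
  | succ j ih => rw [List.replicate_succ, List.cons_append, hv, ih]; ring

theorem HasValue.congr (h : HasValue S φ) (hφ : ∀ v, IsVal v → φ v = ψ v) : HasValue S ψ :=
  let ⟨T, hT, h⟩ := h
  ⟨T, hT, fun v hv => (h v hv).trans (hφ v hv)⟩

theorem HasValue.tmp (h : HasValue S φ) : S .tmp = [] := h.choose_spec.1.tmp

/-- The value of the ledger depends only on the ledger. -/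
theorem HasValue.of_eq (h : HasValue S φ) (ht : S' .tmp = [])
    (hl : ∀ i, S' (.ledger i) = S (.ledger i)) : HasValue S' φ :=
  let ⟨T, hT, h⟩ := h
  ⟨T, ⟨ht, fun i => (hl i).trans (hT.stack i), hT.valid⟩, h⟩

theorem Emits.congr (h : Emits ψ S S') (hψ : ∀ v, IsVal v → ψ v = ψ' v) : Emits ψ' S S' :=
  ⟨h.frame, fun φ hφ => (h.value φ hφ).congr fun v hv => by rw [hψ v hv]⟩

theorem Emits.refl (S : Reg → List Sym) : Emits (fun _ => 0) S S :=
  ⟨fun _ _ => rfl, fun φ h => by simpa using h⟩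

theorem Emits.trans (h : Emits ψ S S₁) (h' : Emits ψ' S₁ S') :
    Emits (fun v => ψ v + ψ' v) S S' :=
  ⟨fun k hk => (h'.frame k hk).trans (h.frame k hk), fun φ hφ =>
    (h'.value _ (h.value φ hφ)).congr fun v _ => by ring⟩

@[simp] theorem addToken_of_ne {i : Fin 3} {x : List Sym} {s : Bool} {k : Reg}
    (h : k ≠ .ledger i) : addToken i x s S k = S k := update_of_ne h _ _

theorem emits_addToken (i : Fin 3) (x : List Sym) (s : Bool) (hx : ∀ a ∈ x, a ∈ tokenSyms) :
    Emits (fun v => sign s * v x) S (addToken i x s S) := by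
  refine ⟨fun k hk => addToken_of_ne (hk i), fun φ ⟨T, hT, h⟩ => ?_⟩
  refine ⟨update T i ((x, s) :: T i), ⟨?_, fun j => ?_, fun j => ?_⟩, fun v hv => ?_⟩
  · simp [hT.tmp]
  · rcases eq_or_ne j i with rfl | hj
    · simp [addToken, hT.stack, enc]
    · simp [addToken_of_ne, hj, hT.stack]
  · rcases eq_or_ne j i with rfl | hj
    · rw [update_self]
      exact List.forall_mem_cons.2 ⟨hx, hT.valid j⟩
    · simpa [hj] using hT.valid j
  · beta_reduce
    rw [← h v hv, Fintype.sum_eq_add_sum_compl i, Fintype.sum_eq_add_sum_compl i, update_self]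
    have : ∑ j ∈ {i}ᶜ, total v (update T i ((x, s) :: T i) j) = ∑ j ∈ {i}ᶜ, total v (T j) :=
      Finset.sum_congr rfl fun j hj => by rw [update_of_ne (by simpa using hj)]
    rw [this]
    simp only [total, List.map_cons, List.sum_cons]
    ring

theorem exec_push_all (k : Reg) (l : List Sym) (S : Reg → List Sym) :
    exec (l.map (.push k)) S = some (update S k (l.reverse ++ S k)) := by
  induction l generalizing S with
  | nil => simp
  | cons a l ih => simp [ih]

/-- A token is built from the bottom up: sign, number, prefix. Hence the prefix appears reversed. -/
theorem emit_sound {X : Reg} {i : Fin 3} {s : Bool} {pre : List Sym} (hX : X ≠ .tmp)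
    (hXi : X ≠ .ledger i) (hS : S .tmp = []) {x : List Bool} (hx : S X = name x)
    (h : Runs (emit X i s pre) t S S') : S' = addToken i (pre.reverse ++ name x) s S := by
  obtain ⟨S₂, h, h₃⟩ := runs_mul h
  obtain ⟨S₁, h₁, h₂⟩ := runs_mul h
  simp only [runs_word, exec_push, exec_nil, exec_push_all, Option.some.injEq] at h₁ h₃
  obtain ⟨-, rfl⟩ := h₁
  obtain ⟨-, rfl⟩ := h₃
  obtain ⟨y, hy, rfl⟩ := copyNum_sound hX (by simp) hXi (by simpa using hS) h₂
  obtain rfl : x = y := by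
    apply name_injective
    rw [← hx, ← hy, update_of_ne hXi]
  simp [addToken]

theorem emit_complete {X : Reg} (i : Fin 3) (s : Bool) (pre : List Sym) (hX : X ≠ .tmp)
    (hXi : X ≠ .ledger i) (hS : S .tmp = []) {x : List Bool} (hx : S X = name x) :
    Runs (emit X i s pre) (5 * x.length + 3 + pre.length) S
      (addToken i (pre.reverse ++ name x) s S) := by
  have h₁ : Runs (word [.push (.ledger i) (.sgn s)]) 1 S
      (update S (.ledger i) (.sgn s :: S (.ledger i))) := runs_word.2 ⟨le_rfl, by simp⟩
  have h₂ := copyNum_complete (S := update S (.ledger i) (.sgn s :: S (.ledger i))) hX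
    (Y := .ledger i) (by simp) hXi (by simpa using hS) (by rw [update_of_ne hXi, hx])
  refine ((h₁.mul h₂).mul (runs_word.2 ⟨le_rfl, ?_⟩)).mono (by simp; omega)
  simp [exec_push_all, addToken]

/-- A scan without source stacks is a guess: it puts the same arbitrary number `j` of ticks on all
three tokens. The extra tick on the negative token balances the `2 ^ j` trains sent to each of the
two successors. -/
theorem fire_sound (hS : S .tmp = []) {u a b : List Bool} (hu : S .ctr = name u)
    (ha : S .fst = name a) (hb : S .snd = name b) (h : Runs fire t S S') :
    ∃ j, S' = addToken 0 (List.replicate (j + 1) .tick ++ name u) false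
      (addToken 1 (List.replicate j .tick ++ name a) true
        (addToken 2 (List.replicate j .tick ++ name b) true S)) := by
  obtain ⟨S₅, h, h₆⟩ := runs_mul h
  obtain ⟨S₄, h, h₅⟩ := runs_mul h
  obtain ⟨S₃, h, h₄⟩ := runs_mul h
  obtain ⟨S₂, h, h₃⟩ := runs_mul h
  obtain ⟨S₁, h₁, h₂⟩ := runs_mul h
  simp only [runs_word, exec_push, exec_nil] at h₁ h₆
  obtain ⟨-, rfl⟩ := h₁
  obtain ⟨-, rfl⟩ := h₆
  obtain ⟨y, hy, rfl⟩ := copyNum_sound (by simp) (by simp) (by simp) (by simpa using hS) h₂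
  obtain rfl : u = y := name_injective (by simpa [hu] using hy)
  obtain ⟨y, hy, rfl⟩ := copyNum_sound (by simp) (by simp) (by simp) (by simpa using hS) h₃
  obtain rfl : a = y := name_injective (by simpa [ha] using hy)
  obtain ⟨y, hy, rfl⟩ := copyNum_sound (by simp) (by simp) (by simp) (by simpa using hS) h₄
  obtain rfl : b = y := name_injective (by simpa [hb] using hy)
  obtain ⟨x, hx, h₅⟩ := runs_scan (by simp) h₅
  obtain ⟨j, rfl⟩ : ∃ j, x = List.replicate j .tick :=
    ⟨x.length, List.eq_replicate_iff.2 ⟨rfl, by simpa using hx⟩⟩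
  refine ⟨j, funext fun k => ?_⟩
  by_cases hk : k ∈ [Reg.ledger 0, .ledger 1, .ledger 2]
  · have := h₅.target k hk
    simp only [List.mem_cons, List.not_mem_nil, or_false] at hk
    rcases hk with rfl | rfl | rfl <;> simp [this, addToken, List.replicate_succ]
  · have := h₅.frame k (by simp) hk
    simp only [List.mem_cons, List.not_mem_nil, or_false, not_or] at hk
    simp [this, hk, addToken]

theorem fire_complete (j : ℕ) (hS : S .tmp = []) {u a b : List Bool} (hu : S .ctr = name u)
    (ha : S .fst = name a) (hb : S .snd = name b) :
    Runs fire (5 * (u.length + a.length + b.length) + 3 * j + 10) S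
      (addToken 0 (List.replicate (j + 1) .tick ++ name u) false
      (addToken 1 (List.replicate j .tick ++ name a) true
        (addToken 2 (List.replicate j .tick ++ name b) true S))) := by
  have h₁ := runs_word (S := S) (t := 3).2
    ⟨le_rfl, (by simp; rfl : exec [.push (.ledger 0) (.sgn false), .push (.ledger 1) (.sgn true),
      .push (.ledger 2) (.sgn true)] S = some _)⟩
  have h₂ := h₁.mul (copyNum_complete (X := .ctr) (Y := .ledger 0) (x := u) (by simp) (by simp)
    (by simp) (by simpa using hS) (by simpa using hu))
  have h₃ := h₂.mul (copyNum_complete (X := .fst) (Y := .ledger 1) (x := a) (by simp) (by simp)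
    (by simp) (by simpa using hS) (by simpa using ha))
  have h₄ := h₃.mul (copyNum_complete (X := .snd) (Y := .ledger 2) (x := b) (by simp) (by simp)
    (by simp) (by simpa using hS) (by simpa using hb))
  have h₅ := h₄.mul (Scan.runs (F := [.tick]) (src := []) (f := id)
    (tgt := [.ledger 0, .ledger 1, .ledger 2]) (x := List.replicate j .tick)
    (S' := addToken 0 (List.replicate j .tick ++ name u) false
      (addToken 1 (List.replicate j .tick ++ name a) true
        (addToken 2 (List.replicate j .tick ++ name b) true S))) ⟨by simp, ?_, ?_⟩
    (by simp) (by simp))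
  · refine (h₅.mul (runs_word.2 ⟨le_rfl, ?_⟩)).mono ?_
    · simp [addToken, List.replicate_succ]
    · simp; omega
  · intro k hk
    simp only [List.mem_cons, List.not_mem_nil, or_false] at hk
    rcases hk with rfl | rfl | rfl <;> simp [addToken]
  · intro k _ hk
    simp only [List.mem_cons, List.not_mem_nil, or_false, not_or] at hk
    simp [hk, addToken]

theorem mem_tokenSyms_of_mem_name (x : List Bool) : ∀ a ∈ name x, a ∈ tokenSyms := by
  intro a ha
  have := mem_bitSyms_of_mem_name x a ha
  simp only [bitSyms, List.mem_cons, List.not_mem_nil, or_false] at this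
  rcases this with rfl | rfl <;> simp [tokenSyms]

theorem emits_star_name (i : Fin 3) (x : List Bool) (s : Bool) :
    Emits (fun v => sign s * v (.star :: name x)) S
      (addToken i ([Sym.star].reverse ++ name x) s S) :=
  emits_addToken i _ s (by simpa [tokenSyms] using mem_tokenSyms_of_mem_name x)

theorem emits_name (i : Fin 3) (x : List Bool) (s : Bool) :
    Emits (fun v => sign s * v (name x)) S
      (addToken i (([] : List Sym).reverse ++ name x) s S) :=
  emits_addToken i _ s (mem_tokenSyms_of_mem_name x)

theorem emits_fire (j : ℕ) (u a b : List Bool) :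
    Emits (fun v => 2 ^ j * (v (name a) + v (name b) - 2 * v (name u))) S
      (addToken 0 (List.replicate (j + 1) .tick ++ name u) false
      (addToken 1 (List.replicate j .tick ++ name a) true
        (addToken 2 (List.replicate j .tick ++ name b) true S))) := by
  have h : ∀ j x, ∀ c ∈ List.replicate j Sym.tick ++ name x, c ∈ tokenSyms := by
    intro j x c hc
    rcases List.mem_append.1 hc with hc | hc
    · simp [List.eq_of_mem_replicate hc, tokenSyms]
    · exact mem_tokenSyms_of_mem_name x c hc
  refine (((emits_addToken 2 _ true (h j b)).trans (emits_addToken 1 _ true (h j a))).trans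
    (emits_addToken 0 _ false (h (j + 1) u))).congr fun v hv => ?_
  simp only [hv.replicate, sign]
  simp
  ring

end Verifier

end Arrival

/-! ### Processing one vertex of the input. -/

namespace Arrival

namespace Verifier

open StackOp Function

/-- Process a vertex: read its successors, certify `k` times that its number occurs, and move trains
from the vertex to its successors. -/
def vertex : RegularExpression (StackOp Reg Sym) :=
  readNum .fst * readNum .snd * emit .fst 0 true [.star] * emit .snd 0 true [.star] *
    (emit .ctr 0 false [.star]).star * fire.star *
    (word [] + emit .ctr 0 false [] * emit .fst 0 true []) * incr

/-- What the verifier reads and guesses at a vertex: the numbers of the successors, how often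
the number of the vertex occurs, and half the number of trains that leave the vertex, with the
remainder. -/
structure VertexData where
  a : List Bool
  b : List Bool
  k : ℕ
  h : ℕ
  r : ℕ

/-- The value added to the ledger at a vertex. -/
def VertexData.value (d : VertexData) (u : List Bool) (v : List Sym → ℤ) : ℤ :=
  v (.star :: name d.a) + v (.star :: name d.b) - d.k * v (.star :: name u) +
    ((d.h + d.r) * v (name d.a) + d.h * v (name d.b) - (2 * d.h + d.r) * v (name u))

/-- The effect of the program `vertex`. -/
structure VertexStep (u : List Bool) (d : VertexData) (S S' : Reg → List Sym) : Prop where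
  rem : d.r ≤ 1
  inp : S .inp = name d.a ++ .sep :: (name d.b ++ .sep :: S' .inp)
  ctr : S' .ctr = name (succBits u)
  fst : S' .fst = name d.a
  snd : S' .snd = name d.b
  tmp : S' .tmp = []
  value : ∀ φ, HasValue S φ → HasValue S' fun v => φ v + d.value u v

variable {S S' S₁ : Reg → List Sym} {t : ℕ} {φ ψ ψ' : (List Sym → ℤ) → ℤ} {v : List Sym → ℤ}

theorem emit_star_sound (hS : S .tmp = []) {u : List Bool} (hu : S .ctr = name u)
    (h : Runs (emit .ctr 0 false [.star]).star t S S') :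
    ∃ k : ℕ, Emits (fun v => -(k * v (.star :: name u))) S S' := by
  replace h := runs_star h
  induction h using Relation.ReflTransGen.head_induction_on with
  | refl => exact ⟨0, (Emits.refl S').congr (by simp)⟩
  | @head S S₁ h _ ih =>
    obtain rfl := emit_sound (by simp) (by simp) hS hu h
    have e := emits_star_name (S := S) 0 u false
    obtain ⟨k, hk⟩ := ih ((e.frame _ (by simp)).trans hS) ((e.frame _ (by simp)).trans hu)
    exact ⟨k + 1, (e.trans hk).congr fun v _ => by simp [sign]; ring⟩

theorem emit_star_complete (k : ℕ) (hS : S .tmp = []) {u : List Bool} (hu : S .ctr = name u) :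
    ∃ S', Runs (emit .ctr 0 false [.star]).star (k * (5 * u.length + 4)) S S' ∧
      Emits (fun v => -(k * v (.star :: name u))) S S' := by
  induction k generalizing S with
  | zero => exact ⟨S, .star_refl, (Emits.refl S).congr (by simp)⟩
  | succ k ih =>
    have h := emit_complete 0 false [.star] (by simp) (by simp) hS hu
    have e := emits_star_name (S := S) 0 u false
    obtain ⟨S', h', e'⟩ := ih (S := addToken 0 ([Sym.star].reverse ++ name u) false S)
      ((e.frame _ (by simp)).trans hS) ((e.frame _ (by simp)).trans hu)
    refine ⟨S', (h.star_head h').mono ?_, (e.trans e').congr fun v _ => by simp [sign]; ring⟩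
    simp only [List.length_cons, List.length_nil, Nat.add_mul]
    omega

/-- Whatever powers of two are guessed, the same total goes to both successors. With the optional
single train to the even successor, this builds the balancing condition into the program. -/
theorem fire_star_sound (hS : S .tmp = []) {u a b : List Bool} (hu : S .ctr = name u)
    (ha : S .fst = name a) (hb : S .snd = name b) (h : Runs fire.star t S S') :
    ∃ h : ℕ, Emits (fun v => h * (v (name a) + v (name b) - 2 * v (name u))) S S' := by
  replace h := runs_star h
  induction h using Relation.ReflTransGen.head_induction_on with
  | refl => exact ⟨0, (Emits.refl S').congr (by simp)⟩
  | @head S S₁ h _ ih =>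
    obtain ⟨j, rfl⟩ := fire_sound hS hu ha hb h
    have e := emits_fire (S := S) j u a b
    obtain ⟨k, hk⟩ := ih ((e.frame _ (by simp)).trans hS) ((e.frame _ (by simp)).trans hu)
      ((e.frame _ (by simp)).trans ha) ((e.frame _ (by simp)).trans hb)
    exact ⟨2 ^ j + k, (e.trans hk).congr fun v _ => by push_cast; ring⟩

/-- One firing for each one in the binary expansion of `h`, from the top bit down: exponentially
many trains are posted in time polynomial in `J`. -/
theorem fire_star_complete (J h : ℕ) (hJ : h < 2 ^ J) (hS : S .tmp = []) {u a b : List Bool}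
    (hu : S .ctr = name u) (ha : S .fst = name a) (hb : S .snd = name b) :
    ∃ S', Runs fire.star (J * (5 * (u.length + a.length + b.length) + 3 * J + 10)) S S' ∧
      Emits (fun v => h * (v (name a) + v (name b) - 2 * v (name u))) S S' := by
  induction J generalizing S h with
  | zero =>
    obtain rfl : h = 0 := by simpa using hJ
    exact ⟨S, .star_refl, (Emits.refl S).congr (by simp)⟩
  | succ J ih =>
    have hle : J * (5 * (u.length + a.length + b.length) + 3 * J + 10) ≤
      J * (5 * (u.length + a.length + b.length) + 3 * (J + 1) + 10) :=
        Nat.mul_le_mul_left _ (by omega)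
    rcases lt_or_ge h (2 ^ J) with hh | hh
    · obtain ⟨S', h', e⟩ := ih h hh hS hu ha hb
      exact ⟨S', h'.mono (by rw [Nat.add_mul]; omega), e⟩
    · have e := emits_fire (S := S) J u a b
      obtain ⟨S', h', e'⟩ := ih (h - 2 ^ J) (by rw [pow_succ] at hJ; omega)
        ((e.frame _ (by simp)).trans hS) ((e.frame _ (by simp)).trans hu)
        ((e.frame _ (by simp)).trans ha) ((e.frame _ (by simp)).trans hb)
      refine ⟨S', ((fire_complete J hS hu ha hb).star_head h').mono ?_,
        (e.trans e').congr fun v _ => ?_⟩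
      · rw [Nat.add_mul]; omega
      · push_cast [hh]; ring

theorem vertex_sound (hS : S .tmp = []) {u : List Bool} (hu : S .ctr = name u)
    (h : Runs vertex t S S') : ∃ d, VertexStep u d S S' := by
  obtain ⟨S₇, h, h₈⟩ := runs_mul h
  obtain ⟨S₆, h, h₇⟩ := runs_mul h
  obtain ⟨S₅, h, h₆⟩ := runs_mul h
  obtain ⟨S₄, h, h₅⟩ := runs_mul h
  obtain ⟨S₃, h, h₄⟩ := runs_mul h
  obtain ⟨S₂, h, h₃⟩ := runs_mul h
  obtain ⟨S₁, h₁, h₂⟩ := runs_mul h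
  obtain ⟨a, ha, e₁⟩ := readNum_sound (by simp) (by simp) hS h₁
  have t₁ : S₁ .tmp = [] := by rw [e₁]; simpa using hS
  obtain ⟨b, hb, e₂⟩ := readNum_sound (by simp) (by simp) t₁ h₂
  have t₂ : S₂ .tmp = [] := by rw [e₂]; simpa using t₁
  have u₂ : S₂ .ctr = name u := by rw [e₂, e₁]; simpa using hu
  have a₂ : S₂ .fst = name a := by rw [e₂, e₁]; simp
  have b₂ : S₂ .snd = name b := by rw [e₂]; simp
  obtain rfl := emit_sound (by simp) (by simp) t₂ a₂ h₃
  have f₃ := emits_star_name (S := S₂) 0 a true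
  obtain rfl := emit_sound (by simp) (by simp) ((f₃.frame _ (by simp)).trans t₂)
    ((f₃.frame _ (by simp)).trans b₂) h₄
  have f₄ := f₃.trans (emits_star_name 0 b true)
  obtain ⟨k, f₅⟩ := emit_star_sound ((f₄.frame _ (by simp)).trans t₂)
    ((f₄.frame _ (by simp)).trans u₂) h₅
  have f₅ := f₄.trans f₅
  obtain ⟨m, f₆⟩ := fire_star_sound ((f₅.frame _ (by simp)).trans t₂)
    ((f₅.frame _ (by simp)).trans u₂) ((f₅.frame _ (by simp)).trans a₂)
    ((f₅.frame _ (by simp)).trans b₂) h₆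
  have f₆ := f₅.trans f₆
  obtain ⟨r, hr, f₇⟩ : ∃ r : ℕ, r ≤ 1 ∧ Emits (fun v => r * (v (name a) - v (name u))) S₆ S₇ := by
    rcases runs_add.1 h₇ with h₇ | h₇
    · simp only [runs_word, exec_nil] at h₇
      obtain ⟨-, rfl⟩ := h₇
      exact ⟨0, by simp, (Emits.refl _).congr (by simp)⟩
    · obtain ⟨S₇', h, h'⟩ := runs_mul h₇
      obtain rfl := emit_sound (by simp) (by simp) ((f₆.frame _ (by simp)).trans t₂)
        ((f₆.frame _ (by simp)).trans u₂) h
      have f := emits_name (S := S₆) 0 u false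
      have f' := f₆.trans f
      obtain rfl := emit_sound (by simp) (by simp) ((f'.frame _ (by simp)).trans t₂)
        ((f'.frame _ (by simp)).trans a₂) h'
      exact ⟨1, le_rfl, (f.trans (emits_name 0 a true)).congr fun v _ => by simp [sign]; ring⟩
  have f₇ := f₆.trans f₇
  have e₈ := incr_sound ((f₇.frame _ (by simp)).trans t₂)
    ((f₇.frame _ (by simp)).trans u₂) h₈
  refine ⟨⟨a, b, k, m, r⟩, hr, ?_, by simp [e₈], ?_, ?_, ?_, fun φ hφ => ?_⟩
  · rw [ha, hb]; simp [e₈, f₇.frame]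
  · simp [e₈, f₇.frame, a₂]
  · simp [e₈, f₇.frame, b₂]
  · simp [e₈, f₇.frame, t₂]
  · have : HasValue S₂ φ := hφ.of_eq t₂ fun i => by rw [e₂, e₁]; simp
    refine ((f₇.value φ this).of_eq (by simp [e₈, f₇.frame, t₂])
      fun i => by rw [e₈]; simp).congr fun v _ => ?_
    simp [VertexData.value, sign]; ring

/-- The bound `B` serves both for the lengths of all numbers involved and for the number of bits of
`d.h`. The numbers `z` and `z'` are leftovers that get discarded. -/
theorem vertex_complete (B : ℕ) (hS : S .tmp = []) {u z z' : List Bool} {c : List Sym}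
    (d : VertexData) (hu : S .ctr = name u) (hz : S .fst = name z) (hz' : S .snd = name z')
    (hc : S .inp = name d.a ++ .sep :: (name d.b ++ .sep :: c))
    (hB : u.length ≤ B ∧ z.length ≤ B ∧ z'.length ≤ B ∧ d.a.length ≤ B ∧ d.b.length ≤ B)
    (hh : d.h < 2 ^ B) (hr : d.r ≤ 1) :
    ∃ S', Runs vertex (5 * d.k * (B + 1) + 44 * (B + 1) ^ 2) S S' ∧ VertexStep u d S S' := by
  obtain ⟨a, b, k, m, r⟩ := d
  simp only at hc hB hh hr
  have h₁ := readNum_complete (X := .fst) (by simp) (by simp) hS hz hc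
  have h₂ := h₁.mul (readNum_complete (X := .snd) (x := b) (z := z') (r := c) (by simp) (by simp)
    (by simpa using hS) (by simpa using hz') (by simp))
  obtain ⟨S₂, e₂⟩ : ∃ S₂, S₂ = update (update (update (update S .inp
    (name b ++ .sep :: c)) .fst (name a)) .inp c) .snd (name b) := ⟨_, rfl⟩
  rw [← e₂] at h₂
  have t₂ : S₂ .tmp = [] := by rw [e₂]; simpa using hS
  have u₂ : S₂ .ctr = name u := by rw [e₂]; simpa using hu
  have a₂ : S₂ .fst = name a := by rw [e₂]; simp
  have b₂ : S₂ .snd = name b := by rw [e₂]; simp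
  have c₂ : S₂ .inp = c := by rw [e₂]; simp
  have h₃ := h₂.mul (emit_complete 0 true [.star] (by simp) (by simp) t₂ a₂)
  have f₃ := emits_star_name (S := S₂) 0 a true
  have h₄ := h₃.mul (emit_complete (X := .snd) (x := b) 0 true [.star] (by simp) (by simp)
    ((f₃.frame _ (by simp)).trans t₂) ((f₃.frame _ (by simp)).trans b₂))
  have f₄ := f₃.trans (emits_star_name 0 b true)
  obtain ⟨S₅, h₅, f₅⟩ := emit_star_complete k (u := u) ((f₄.frame _ (by simp)).trans t₂)
    ((f₄.frame _ (by simp)).trans u₂)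
  have h₅ := h₄.mul h₅
  have f₅ := f₄.trans f₅
  obtain ⟨S₆, h₆, f₆⟩ := fire_star_complete B m hh (u := u) (a := a) (b := b)
    ((f₅.frame _ (by simp)).trans t₂)
    ((f₅.frame _ (by simp)).trans u₂) ((f₅.frame _ (by simp)).trans a₂)
    ((f₅.frame _ (by simp)).trans b₂)
  have h₆ := h₅.mul h₆
  have f₆ := f₅.trans f₆
  obtain ⟨S₇, h₇, f₇⟩ : ∃ S₇, Runs (word [] + emit .ctr 0 false [] * emit .fst 0 true [])
      (10 * B + 6) S₆ S₇ ∧ Emits (fun v => r * (v (name a) - v (name u))) S₆ S₇ := by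
    rcases Nat.le_one_iff_eq_zero_or_eq_one.1 hr with rfl | rfl
    · exact ⟨S₆, runs_add.2 (Or.inl (runs_word.2 ⟨by simp, by simp⟩)),
        (Emits.refl _).congr (by simp)⟩
    · have h := emit_complete (S := S₆) (X := .ctr) (x := u) 0 false [] (by simp) (by simp)
        ((f₆.frame _ (by simp)).trans t₂) ((f₆.frame _ (by simp)).trans u₂)
      have f := emits_name (S := S₆) 0 u false
      have f' := f₆.trans f
      have h' := h.mul (emit_complete (X := .fst) (x := a) 0 true [] (by simp) (by simp)
        ((f'.frame _ (by simp)).trans t₂) ((f'.frame _ (by simp)).trans a₂))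
      exact ⟨_, runs_add.2 (Or.inr (h'.mono (by simp; omega))),
        (f.trans (emits_name 0 a true)).congr fun v _ => by simp [sign]; ring⟩
  have h₇ := h₆.mul h₇
  have f₇ := f₆.trans f₇
  have h₈ := h₇.mul (incr_complete ((f₇.frame _ (by simp)).trans t₂)
    ((f₇.frame _ (by simp)).trans u₂))
  refine ⟨_, h₈.mono ?_, hr, ?_, by simp, ?_, ?_, ?_, fun φ hφ => ?_⟩
  · have i₁ : k * (5 * u.length + 4) ≤ 5 * k * (B + 1) := by
      rw [mul_comm 5 k, mul_assoc]; exact Nat.mul_le_mul_left _ (by omega)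
    have i₂ : B * (5 * (u.length + a.length + b.length) + 3 * B + 10) ≤ B * (18 * B + 10) :=
      Nat.mul_le_mul_left _ (by omega)
    simp only [List.length_cons, List.length_nil]
    nlinarith
  · simp [hc, f₇.frame, c₂]
  · simp [f₇.frame, a₂]
  · simp [f₇.frame, b₂]
  · simp [f₇.frame, t₂]
  · have : HasValue S₂ φ := hφ.of_eq t₂ fun i => by rw [e₂]; simp
    refine ((f₇.value φ this).of_eq (by simp [f₇.frame, t₂])
      fun i => by simp).congr fun v _ => ?_
    simp [VertexData.value, sign]; ring

end Verifier

end Arrival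

/-! ### Elementary simplifications of the ledger. -/

namespace Arrival

namespace Verifier

open StackOp Function

/-- Move a token from one stack of the ledger to another. -/
def moveToken (i j : Fin 3) : RegularExpression (StackOp Reg Sym) :=
  scan tokenSyms [.ledger i] id [.tmp] *
    anyOf ([false, true].map fun s =>
      word [.pop (.ledger i) (.sgn s), .push (.ledger j) (.sgn s)]) *
    scan tokenSyms [.tmp] id [.ledger j] * word [.empty .tmp]

/-- Remove two tokens with the same word and opposite signs. -/
def cancel : RegularExpression (StackOp Reg Sym) :=
  scan tokenSyms [.ledger 0, .ledger 1] id [] *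
    anyOf ([false, true].map fun s => word [.pop (.ledger 0) (.sgn s), .pop (.ledger 1) (.sgn !s)])

/-- Replace two equal tokens by a token with an additional tick. -/
def merge : RegularExpression (StackOp Reg Sym) :=
  scan tokenSyms [.ledger 0, .ledger 1] id [.tmp] *
    anyOf ([false, true].map fun s => word [.pop (.ledger 0) (.sgn s), .pop (.ledger 1) (.sgn s),
      .push (.ledger 0) (.sgn s)]) *
    scan tokenSyms [.tmp] id [.ledger 0] * word [.empty .tmp, .push (.ledger 0) .tick]

/-- A step in the simplification of the ledger. -/
def reduceStep : RegularExpression (StackOp Reg Sym) :=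
  anyOf [moveToken 0 1, moveToken 0 2, moveToken 1 0, moveToken 2 0, cancel, merge]

variable {S S' S₁ : Reg → List Sym} {t : ℕ} {φ : (List Sym → ℤ) → ℤ} {v : List Sym → ℤ}
  {T : Fin 3 → List Token}

theorem runs_sgn {f : Bool → List (StackOp Reg Sym)}
    (h : Runs (anyOf ([false, true].map fun s => word (f s))) t S S') :
    ∃ s, exec (f s) S = some S' := by
  obtain ⟨P, hP, h⟩ := runs_anyOf.1 h
  obtain ⟨s, -, rfl⟩ := List.mem_map.1 hP
  exact ⟨s, (runs_word.1 h).2⟩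

theorem Runs.sgn {f : Bool → List (StackOp Reg Sym)} (s : Bool) (h : exec (f s) S = some S') :
    Runs (anyOf ([false, true].map fun s => word (f s))) (f s).length S S' :=
  runs_anyOf.2 ⟨_, List.mem_map.2 ⟨s, by cases s <;> simp, rfl⟩, runs_word.2 ⟨le_rfl, h⟩⟩

/-- Signs do not occur in the words of tokens, so they act as terminators and a ledger stack can be
parsed in only one way. -/
theorem append_sgn_inj {x y r r' : List Sym} {s s' : Bool} (hx : ∀ a ∈ x, a ∈ tokenSyms)
    (hy : ∀ a ∈ y, a ∈ tokenSyms) (h : x ++ .sgn s :: r = y ++ .sgn s' :: r') :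
    x = y ∧ s = s' ∧ r = r' := by
  induction x generalizing y with
  | nil =>
    cases y with
    | nil => simpa using h
    | cons a y =>
      obtain rfl : Sym.sgn s = a := by simpa using (List.cons.inj h).1
      exact absurd (hy (.sgn s) (by simp)) (by simp [tokenSyms])
  | cons a x ih =>
    cases y with
    | nil =>
      obtain rfl : a = Sym.sgn s' := by simpa using (List.cons.inj h).1
      exact absurd (hx (.sgn s') (by simp)) (by simp [tokenSyms])
    | cons b y =>
      rw [List.forall_mem_cons] at hx hy
      obtain ⟨rfl, h'⟩ := List.cons.inj h
      obtain ⟨rfl, h''⟩ := ih hx.2 hy.2 h'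
      exact ⟨rfl, h''⟩

theorem Ledger.eq_cons (hT : Ledger S T) {i : Fin 3} {x r : List Sym} {s : Bool}
    (hx : ∀ a ∈ x, a ∈ tokenSyms) (h : S (.ledger i) = x ++ .sgn s :: r) :
    ∃ l, T i = (x, s) :: l ∧ r = enc l := by
  have hv := hT.valid i
  rw [hT.stack i] at h
  cases hl : T i with
  | nil => simp [hl, enc] at h
  | cons p l =>
    rw [hl, List.forall_mem_cons] at hv
    rw [hl] at h
    obtain ⟨rfl, rfl, rfl⟩ := append_sgn_inj hv.1 hx (by simpa [enc] using h)
    exact ⟨l, rfl, by simp [enc]⟩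

theorem enc_cons (x : List Sym) (s : Bool) (l : List Token) :
    enc ((x, s) :: l) = x ++ .sgn s :: enc l := by simp [enc]

theorem Ledger.valid_cons (hT : Ledger S T) {i : Fin 3} {x : List Sym} {s : Bool}
    {l : List Token} (h : T i = (x, s) :: l) :
    (∀ a ∈ x, a ∈ tokenSyms) ∧ ∀ p ∈ l, ∀ a ∈ p.1, a ∈ tokenSyms := by
  have := hT.valid i
  rw [h] at this
  exact List.forall_mem_cons.1 this

/-- Update two of the ledger stacks. -/
theorem Ledger.update₂ (hT : Ledger S T) {i j : Fin 3} {l l' : List Token}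
    (hij : i ≠ j) (ht : S' .tmp = []) (hi : S' (.ledger i) = enc l)
    (hj : S' (.ledger j) = enc l') (h : ∀ k, k ≠ i → k ≠ j → S' (.ledger k) = S (.ledger k))
    (hl : ∀ p ∈ l, ∀ a ∈ p.1, a ∈ tokenSyms) (hl' : ∀ p ∈ l', ∀ a ∈ p.1, a ∈ tokenSyms) :
    Ledger S' (update (update T i l) j l') := by
  refine ⟨ht, fun k => ?_, fun k => ?_⟩ <;> rcases eq_or_ne k j with rfl | hkj
  · simpa using hj
  · rcases eq_or_ne k i with rfl | hki
    · simpa [hij] using hi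
    · simpa [hkj, hki, h k hki hkj] using hT.stack k
  · rw [update_self]; exact hl'
  · rcases eq_or_ne k i with rfl | hki
    · rw [update_of_ne hij, update_self]; exact hl
    · rw [update_of_ne hkj, update_of_ne hki]; exact hT.valid k

/-- Popping a sign after the scan ensures that exactly one whole token was taken. The detour over
`tmp` keeps its word in order. -/
theorem moveToken_sound {i j : Fin 3} (hij : i ≠ j) (hT : Ledger S T)
    (h : Runs (moveToken i j) t S S') :
    ∃ x s l, T i = (x, s) :: l ∧ Ledger S' (update (update T i l) j ((x, s) :: T j)) := by
  obtain ⟨S₃, h, h₄⟩ := runs_mul h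
  obtain ⟨S₂, h, h₃⟩ := runs_mul h
  obtain ⟨S₁, h₁, q⟩ := runs_mul h
  obtain ⟨x, hx, h₁⟩ := runs_scan (by simp) h₁
  obtain ⟨s, h₂⟩ := runs_sgn q
  obtain ⟨y, -, h₃⟩ := runs_scan (by simp) h₃
  simp only [runs_word, exec_nil, exec_empty, exec_pop, exec_push] at h₂ h₄
  obtain ⟨r, h₂, rfl⟩ := h₂
  obtain ⟨-, h₄, rfl⟩ := h₄
  have e₁ := h₁.source (.ledger i) (by simp)
  rw [h₂] at e₁
  obtain ⟨l, hl, rfl⟩ := hT.eq_cons hx e₁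
  have e₂ := h₁.target .tmp (by simp)
  have e₃ := h₃.source .tmp (by simp)
  have e₄ := h₃.target (.ledger j) (by simp)
  have e₅ := h₁.frame (.ledger j) (by simp [hij.symm]) (by simp)
  have hy : y = x.reverse := by simpa [e₂, hT.tmp, h₄] using e₃.symm
  refine ⟨x, s, l, hl, hT.update₂ hij h₄ ?_ ?_ (fun k hki hkj => ?_) (hT.valid_cons hl).2
    (List.forall_mem_cons.2 ⟨hx, hT.valid j⟩)⟩
  · rw [h₃.frame _ (by simp) (by simp [hij])]; simp [hij]
  · rw [e₄, hy, enc_cons]; simp [hij.symm, e₅, hT.stack j]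
  · rw [h₃.frame _ (by simp) (by simp [hkj]), update_of_ne (by simpa using hkj),
      update_of_ne (by simpa using hki), h₁.frame _ (by simp [hki]) (by simp)]

theorem moveToken_complete {i j : Fin 3} (hij : i ≠ j) (hT : Ledger S T) {x : List Sym} {s : Bool}
    {l : List Token} (hl : T i = (x, s) :: l) :
    ∃ S', Runs (moveToken i j) (4 * x.length + 3) S S' ∧
      Ledger S' (update (update T i l) j ((x, s) :: T j)) := by
  obtain ⟨hx, hl'⟩ := hT.valid_cons hl
  have hi : S (.ledger i) = x ++ .sgn s :: enc l := by rw [hT.stack i, hl, enc_cons]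
  have h₁ : Scan [.ledger i] id [.tmp] x S
      (update (update S (.ledger i) (.sgn s :: enc l)) .tmp x.reverse) :=
    ⟨by simp [hi], by simp [hT.tmp], by simp +contextual⟩
  have h₃ : Scan [.tmp] id [.ledger j] x.reverse
      (update (update (update (update S (.ledger i) (.sgn s :: enc l)) .tmp x.reverse)
        (.ledger i) (enc l)) (.ledger j) (.sgn s :: S (.ledger j)))
      (update (update S (.ledger i) (enc l)) (.ledger j) (x ++ .sgn s :: S (.ledger j))) := by
    refine ⟨by simp [hT.tmp], by simp, fun k hk hkj => ?_⟩
    simp only [List.mem_singleton] at hk hkj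
    simp only [update_apply]
    split_ifs <;> simp_all
  refine ⟨update (update S (.ledger i) (enc l)) (.ledger j) (x ++ .sgn s :: S (.ledger j)),
    ((((h₁.runs (by simp) hx).mul (Runs.sgn s ?_)).mul
    (h₃.runs (by simp) (by simpa using hx))).mul (runs_word.2 ⟨le_rfl, ?_⟩)).mono ?_,
    hT.update₂ hij ?_ ?_ ?_ (fun k hki hkj => ?_) hl' (List.forall_mem_cons.2 ⟨hx, hT.valid j⟩)⟩
  · simp [hij.symm]
  · simp [hT.tmp]
  · simp; omega
  · simp [hT.tmp]
  · simp [hij]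
  · simp [hT.stack, enc_cons]
  · simp [hki, hkj]

/-- The parallel scan removes equal symbols only, and both stacks must show a sign afterwards. Hence
the two top words agree. -/
theorem cancel_sound (hT : Ledger S T) (h : Runs cancel t S S') :
    ∃ x s l l', T 0 = (x, s) :: l ∧ T 1 = (x, !s) :: l' ∧
      Ledger S' (update (update T 0 l) 1 l') := by
  obtain ⟨S₁, h₁, q⟩ := runs_mul h
  obtain ⟨x, hx, h₁⟩ := runs_scan (by simp) h₁
  obtain ⟨s, h₂⟩ := runs_sgn q
  simp only [exec_nil, exec_pop] at h₂
  obtain ⟨r, h₂, r', h₃, rfl⟩ := h₂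
  rw [update_of_ne (by simp)] at h₃
  have e₁ := h₁.source (.ledger 0) (by simp)
  have e₂ := h₁.source (.ledger 1) (by simp)
  rw [h₂] at e₁
  rw [h₃] at e₂
  obtain ⟨l, hl, rfl⟩ := hT.eq_cons hx e₁
  obtain ⟨l', hl', rfl⟩ := hT.eq_cons hx e₂
  refine ⟨x, s, l, l', hl, hl', hT.update₂ (by simp) ?_ (by simp) (by simp)
    (fun k hki hkj => ?_) (hT.valid_cons hl).2 (hT.valid_cons hl').2⟩
  · simp [h₁.frame, hT.tmp]
  · simp [hki, hkj, h₁.frame]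

theorem cancel_complete (hT : Ledger S T) {x : List Sym} {s : Bool} {l l' : List Token}
    (hl : T 0 = (x, s) :: l) (hl' : T 1 = (x, !s) :: l') :
    ∃ S', Runs cancel (2 * x.length + 2) S S' ∧ Ledger S' (update (update T 0 l) 1 l') := by
  obtain ⟨hx, hv⟩ := hT.valid_cons hl
  have h₀ : S (.ledger 0) = x ++ .sgn s :: enc l := by rw [hT.stack, hl, enc_cons]
  have h₁ : S (.ledger 1) = x ++ .sgn (!s) :: enc l' := by rw [hT.stack, hl', enc_cons]
  have h : Scan [.ledger 0, .ledger 1] id [] x S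
      (update (update S (.ledger 0) (.sgn s :: enc l)) (.ledger 1) (.sgn (!s) :: enc l')) := by
    refine ⟨by simp [h₀, h₁], by simp, fun k hk _ => ?_⟩
    simp only [List.mem_cons, List.not_mem_nil, or_false, not_or] at hk
    simp [hk]
  refine ⟨update (update S (.ledger 0) (enc l)) (.ledger 1) (enc l'),
    ((h.runs (by simp) hx).mul (Runs.sgn s ?_)).mono (by simp; omega),
    hT.update₂ (by simp) ?_ (by simp) (by simp) (fun k hki hkj => ?_) hv (hT.valid_cons hl').2⟩
  · refine exec_pop.2 ⟨enc l, by simp, exec_pop.2 ⟨enc l', by simp, exec_nil.2 ?_⟩⟩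
    funext k
    simp only [update_apply]
    split_ifs <;> simp_all
  · simp [hT.tmp]
  · simp [hki, hkj]

/-- The words are compared as in `cancel`, but one copy is kept on `tmp` so that it can be put back
with a tick. -/
theorem merge_sound (hT : Ledger S T) (h : Runs merge t S S') :
    ∃ x s l l', T 0 = (x, s) :: l ∧ T 1 = (x, s) :: l' ∧
      Ledger S' (update (update T 0 ((.tick :: x, s) :: l)) 1 l') := by
  obtain ⟨S₃, h, h₄⟩ := runs_mul h
  obtain ⟨S₂, h, h₃⟩ := runs_mul h
  obtain ⟨S₁, h₁, q⟩ := runs_mul h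
  obtain ⟨x, hx, h₁⟩ := runs_scan (by simp) h₁
  obtain ⟨s, h₂⟩ := runs_sgn q
  obtain ⟨y, -, h₃⟩ := runs_scan (by simp) h₃
  simp only [runs_word, exec_nil, exec_empty, exec_pop, exec_push] at h₂ h₄
  obtain ⟨r, h₂, r', h₂', rfl⟩ := h₂
  obtain ⟨-, h₄, rfl⟩ := h₄
  rw [update_of_ne (by simp)] at h₂'
  have e₁ := h₁.source (.ledger 0) (by simp)
  have e₂ := h₁.source (.ledger 1) (by simp)
  rw [h₂] at e₁
  rw [h₂'] at e₂
  obtain ⟨l, hl, rfl⟩ := hT.eq_cons hx e₁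
  obtain ⟨l', hl', rfl⟩ := hT.eq_cons hx e₂
  have e₃ := h₁.target .tmp (by simp)
  have e₄ := h₃.source .tmp (by simp)
  have e₅ := h₃.target (.ledger 0) (by simp)
  have hy : y = x.reverse := by simpa [e₃, hT.tmp, h₄] using e₄.symm
  refine ⟨x, s, l, l', hl, hl', hT.update₂ (by simp) ?_ ?_ ?_ (fun k hki hkj => ?_)
    (List.forall_mem_cons.2 ⟨?_, (hT.valid_cons hl).2⟩) (hT.valid_cons hl').2⟩
  · simp [h₄]
  · simp [e₅, hy, enc_cons]
  · rw [update_of_ne (by simp), h₃.frame _ (by simp) (by simp)]; simp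
  · rw [update_of_ne (by simpa using hki), h₃.frame _ (by simp) (by simp [hki])]
    simp [hki, hkj, h₁.frame]
  · simpa [tokenSyms] using hx

theorem merge_complete (hT : Ledger S T) {x : List Sym} {s : Bool} {l l' : List Token}
    (hl : T 0 = (x, s) :: l) (hl' : T 1 = (x, s) :: l') :
    ∃ S', Runs merge (5 * x.length + 5) S S' ∧
      Ledger S' (update (update T 0 ((.tick :: x, s) :: l)) 1 l') := by
  obtain ⟨hx, hv⟩ := hT.valid_cons hl
  have h₀ : S (.ledger 0) = x ++ .sgn s :: enc l := by rw [hT.stack, hl, enc_cons]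
  have h₁ : S (.ledger 1) = x ++ .sgn s :: enc l' := by rw [hT.stack, hl', enc_cons]
  have s₁ : Scan [.ledger 0, .ledger 1] id [.tmp] x S
      (update (update (update S (.ledger 0) (.sgn s :: enc l)) (.ledger 1) (.sgn s :: enc l'))
        .tmp x.reverse) := by
    refine ⟨by simp [h₀, h₁], by simp [hT.tmp], fun k hk hk' => ?_⟩
    simp only [List.mem_cons, List.not_mem_nil, or_false, not_or] at hk hk'
    simp [hk, hk']
  have s₂ : Scan [.tmp] id [.ledger 0] x.reverse
      (update (update (update S (.ledger 0) (.sgn s :: enc l)) (.ledger 1) (enc l'))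
        .tmp x.reverse)
      (update (update S (.ledger 0) (x ++ .sgn s :: enc l)) (.ledger 1) (enc l')) := by
    refine ⟨by simp [hT.tmp], by simp, fun k hk hkj => ?_⟩
    simp only [List.mem_singleton] at hk hkj
    simp [update_apply, hk, hkj]
  refine ⟨update (update S (.ledger 0) (.tick :: (x ++ .sgn s :: enc l))) (.ledger 1) (enc l'),
    ((((s₁.runs (by simp) hx).mul (Runs.sgn s ?_)).mul
      (s₂.runs (by simp) (by simpa using hx))).mul (runs_word.2 ⟨le_rfl, ?_⟩)).mono ?_,
    hT.update₂ (by simp) ?_ (by simp [enc_cons]) (by simp) (fun k hki hkj => ?_)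
      (List.forall_mem_cons.2 ⟨by simpa [tokenSyms] using hx, hv⟩) (hT.valid_cons hl').2⟩
  · refine exec_pop.2 ⟨enc l, by simp, exec_pop.2 ⟨enc l', by simp, ?_⟩⟩
    rw [exec_push, exec_nil]
    funext k
    simp only [update_apply]
    split_ifs <;> simp_all
  · rw [exec_empty, exec_push, exec_nil]
    refine ⟨by simp [hT.tmp], funext fun k => ?_⟩
    simp only [update_apply]
    split_ifs <;> simp_all
  · simp; omega
  · simp [hT.tmp]
  · simp [hki, hkj]

end Verifier

end Arrival

/-! ### Emptying a ledger of value zero. -/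

namespace Arrival

namespace Verifier

open StackOp Function

variable {S S' S₁ : Reg → List Sym} {t : ℕ} {φ : (List Sym → ℤ) → ℤ} {v : List Sym → ℤ}
  {T : Fin 3 → List Token}

theorem total_cons (v : List Sym → ℤ) (p : Token) (l : List Token) :
    total v (p :: l) = sign p.2 * v p.1 + total v l := by simp [total]

theorem total_append (v : List Sym → ℤ) (l l' : List Token) :
    total v (l ++ l') = total v l + total v l' := by simp [total]

theorem total_reverse (v : List Sym → ℤ) (l : List Token) : total v l.reverse = total v l := by
  rw [total, List.map_reverse, List.sum_reverse, total]

/-- The invariant behind soundness. Only merging uses that valuations double with each tick. -/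
theorem HasValue.of_reduceStep (hS : HasValue S φ) (h : Runs reduceStep t S S') :
    HasValue S' φ := by
  obtain ⟨T, hT, hv⟩ := hS
  obtain ⟨P, hP, h⟩ := runs_anyOf.1 h
  have key : ∀ T', Ledger S' T' → (∀ v, IsVal v → ∑ i, total v (T' i) = ∑ i, total v (T i)) →
      HasValue S' φ := fun T' hT' h' => ⟨T', hT', fun v h => (h' v h).trans (hv v h)⟩
  simp only [List.mem_cons, List.not_mem_nil, or_false] at hP
  rcases hP with rfl | rfl | rfl | rfl | rfl | rfl
  · obtain ⟨x, s, l, hl, h⟩ := moveToken_sound (by simp) hT h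
    refine key _ h fun v _ => ?_
    simp [Fin.sum_univ_three, hl, total_cons]; ring
  · obtain ⟨x, s, l, hl, h⟩ := moveToken_sound (by simp) hT h
    refine key _ h fun v _ => ?_
    simp [Fin.sum_univ_three, hl, total_cons]; ring
  · obtain ⟨x, s, l, hl, h⟩ := moveToken_sound (by simp) hT h
    refine key _ h fun v _ => ?_
    simp [Fin.sum_univ_three, hl, total_cons]; ring
  · obtain ⟨x, s, l, hl, h⟩ := moveToken_sound (by simp) hT h
    refine key _ h fun v _ => ?_
    simp [Fin.sum_univ_three, hl, total_cons]; ring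
  · obtain ⟨x, s, l, l', hl, hl', h⟩ := cancel_sound hT h
    refine key _ h fun v _ => ?_
    cases s <;> simp [Fin.sum_univ_three, hl, hl', total_cons, sign] <;> ring
  · obtain ⟨x, s, l, l', hl, hl', h⟩ := merge_sound hT h
    refine key _ h fun v hv => ?_
    simp [Fin.sum_univ_three, hl, hl', total_cons, hv x]; ring

theorem HasValue.of_reduceStep_star (hS : HasValue S φ) (h : Runs reduceStep.star t S S') :
    HasValue S' φ := by
  replace h := runs_star h
  induction h with
  | refl => exact hS
  | tail _ h ih => exact ih.of_reduceStep h

theorem HasValue.eq_zero (hS : HasValue S φ) (h : ∀ i, S (.ledger i) = []) (hv : IsVal v) :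
    φ v = 0 := by
  obtain ⟨T, hT, h'⟩ := hS
  rw [← h' v hv]
  refine Finset.sum_eq_zero fun i _ => ?_
  have := hT.stack i
  rw [h i] at this
  cases hi : T i with
  | nil => rfl
  | cons p l => simp [hi, enc] at this

/-- The place that a word stands for. -/
def base (x : List Sym) : List Sym := x.dropWhile (· == .tick)

/-- The number of ticks of a word. -/
def ticks (x : List Sym) : ℕ := (x.takeWhile (· == .tick)).length

theorem base_ticks (x : List Sym) : x = List.replicate (ticks x) .tick ++ base x := by
  conv_lhs => rw [← List.takeWhile_append_dropWhile (p := (· == Sym.tick)) (l := x)]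
  rw [base]
  congr 1
  refine List.eq_replicate_iff.2 ⟨rfl, fun a ha => ?_⟩
  simpa using List.mem_takeWhile_imp ha

/-- The valuation that counts the units at a place. -/
def units (y x : List Sym) : ℤ := if base x = y then 2 ^ ticks x else 0

theorem isVal_units (y : List Sym) : IsVal (units y) := by
  intro x
  have h₁ : base (.tick :: x) = base x := by simp [base]
  have h₂ : ticks (.tick :: x) = ticks x + 1 := by simp [ticks]
  rw [units, units, h₁, h₂]
  split_ifs <;> ring

/-- Choose a place that occurs and a token `p` there with the fewest ticks. If all words were
distinct, every other token at this place would have more ticks. Counting units there would give `±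
2 ^ ticks p.1` modulo the next power of two, which is not zero. -/
theorem not_nodup_of_total_eq_zero {l : List Token} (hl : l ≠ [])
    (h : ∀ v, IsVal v → total v l = 0) : ¬ (l.map Prod.fst).Nodup := by
  intro hn
  obtain ⟨p₀, hp₀⟩ := List.exists_mem_of_ne_nil l hl
  obtain ⟨p, hp, hmin⟩ := (l.toFinset.filter fun q => base q.1 = base p₀.1).exists_min_image
    (fun q => ticks q.1) ⟨p₀, by simp [hp₀]⟩
  simp only [Finset.mem_filter, List.mem_toFinset] at hp hmin
  obtain ⟨l₁, l₂, rfl⟩ := List.append_of_mem hp.1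
  -- Base and ticks determine a word, so a different word at the same base has strictly more ticks;
  -- words at other bases contribute zero.
  have hdvd : ∀ l' : List Token, (∀ q ∈ l', q ∈ l₁ ++ p :: l₂ ∧ q.1 ≠ p.1) →
      (2 : ℤ) ^ (ticks p.1 + 1) ∣ total (units (base p.1)) l' := by
    intro l' hl'
    refine List.dvd_sum fun z hz => ?_
    obtain ⟨q, hq, rfl⟩ := List.mem_map.1 hz
    refine Dvd.dvd.mul_left ?_ _
    rw [units]
    split_ifs with hb
    · refine pow_dvd_pow _ (lt_of_le_of_ne (hmin q ⟨(hl' q hq).1, hb.trans hp.2⟩) fun he => ?_)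
      exact (hl' q hq).2 (by rw [base_ticks q.1, base_ticks p.1, he, hb])
    · exact dvd_zero _
  have hne : ∀ q ∈ l₁ ++ l₂, q ∈ l₁ ++ p :: l₂ ∧ q.1 ≠ p.1 := by
    intro q hq
    refine ⟨by simp only [List.mem_append, List.mem_cons] at hq ⊢; tauto, fun he => ?_⟩
    have := (List.perm_middle.map Prod.fst).nodup_iff.1 hn
    rw [List.map_cons, List.nodup_cons] at this
    exact this.1 (List.mem_map.2 ⟨q, hq, he⟩)
  have h₁ := h _ (isVal_units (base p.1))
  have h₂ := hdvd _ hne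
  rw [total_append] at h₂
  rw [total_append, total_cons] at h₁
  have h₃ : (2 : ℤ) ^ (ticks p.1 + 1) ∣ sign p.2 * 2 ^ ticks p.1 := by
    have : sign p.2 * 2 ^ ticks p.1 =
        -(total (units (base p.1)) l₁ + total (units (base p.1)) l₂) := by
      simp only [units, if_true] at h₁ ⊢
      linarith
    rw [this]
    exact h₂.neg_right
  have h₄ : (2 : ℤ) ^ (ticks p.1 + 1) ∣ 2 ^ ticks p.1 := by
    rcases p with ⟨x, _ | _⟩ <;> simpa [sign] using h₃
  have h₅ := Int.le_of_dvd (by positivity) h₄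
  rw [pow_succ] at h₅
  have : (0 : ℤ) < 2 ^ ticks p.1 := by positivity
  linarith

theorem exists_eq_of_not_nodup {l : List Token} (h : ¬ (l.map Prod.fst).Nodup) :
    ∃ l₁ x s l₂ s' l₃, l = l₁ ++ (x, s) :: (l₂ ++ (x, s') :: l₃) := by
  induction l with
  | nil => simp at h
  | cons p l ih =>
    rw [List.map_cons, List.nodup_cons, not_and_or, not_not] at h
    rcases h with h | h
    · obtain ⟨⟨x, s'⟩, hq, hx⟩ := List.mem_map.1 h
      obtain ⟨l₂, l₃, rfl⟩ := List.append_of_mem hq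
      exact ⟨[], x, p.2, l₂, s', l₃, by simp only at hx; simp [hx]⟩
    · obtain ⟨l₁, x, s, l₂, s', l₃, rfl⟩ := ih h
      exact ⟨p :: l₁, x, s, l₂, s', l₃, rfl⟩

/-- The length of `enc` counts the sign of each token too, so `4 * (enc l).length` absorbs the
constant cost of a single move. -/
theorem moveTokens_complete {i j : Fin 3} (hij : i ≠ j)
    (hm : moveToken i j ∈
      [moveToken 0 1, moveToken 0 2, moveToken 1 0, moveToken 2 0, cancel, merge])
    (l r : List Token) (hT : Ledger S T) (hl : T i = l ++ r) :
    ∃ S' T', Runs reduceStep.star (4 * (enc l).length) S S' ∧ Ledger S' T' ∧ T' i = r ∧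
      T' j = l.reverse ++ T j ∧ ∀ k, k ≠ i → k ≠ j → T' k = T k := by
  induction l generalizing S T with
  | nil => exact ⟨S, T, .star_refl, hT, hl, rfl, fun _ _ _ => rfl⟩
  | cons p l ih =>
    obtain ⟨x, s⟩ := p
    obtain ⟨S₁, h₁, hT₁⟩ := moveToken_complete hij hT hl
    obtain ⟨S', T', h', hT', hi, hj, hk⟩ := ih hT₁ (by simp [hij])
    refine ⟨S', T', (Runs.star_head (runs_anyOf.2 ⟨_, hm, h₁⟩) h').mono ?_, hT', hi,
      by simp [hj], fun k hki hkj => by simp [hk k hki hkj, hki, hkj]⟩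
    simp only [enc_cons, List.length_append, List.length_cons]
    omega

theorem enc_nil : enc [] = [] := rfl

theorem length_enc_append (l l' : List Token) :
    (enc (l ++ l')).length = (enc l).length + (enc l').length := by simp [enc]

theorem length_enc_reverse (l : List Token) : (enc l.reverse).length = (enc l).length := by
  induction l with
  | nil => rfl
  | cons p l ih =>
    rw [List.reverse_cons, length_enc_append, ih, ← List.singleton_append (l := l),
      length_enc_append, add_comm]

theorem length_le_length_enc (l : List Token) : l.length ≤ (enc l).length := by
  induction l with
  | nil => simp
  | cons p l ih =>
    rw [← List.singleton_append, length_enc_append, List.length_append]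
    simp [enc]
    omega

/-- Two tokens with equal words are brought to the tops of stacks 0 and 1, with the tokens above
them parked on stack 2. They are merged or cancelled, and the parked tokens return. -/
theorem reduceStep_complete {l : List Token} (hT : Ledger S T) (h₀ : T 0 = l) (h₁ : T 1 = [])
    (h₂ : T 2 = []) (hl : l ≠ []) (h : ∀ v, IsVal v → total v l = 0) :
    ∃ S' T' l', Runs reduceStep.star (10 * (enc l).length) S S' ∧ Ledger S' T' ∧ T' 0 = l' ∧
      T' 1 = [] ∧ T' 2 = [] ∧ l'.length < l.length ∧ (enc l').length ≤ (enc l).length ∧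
      ∀ v, IsVal v → total v l' = 0 := by
  obtain ⟨l₁, x, s, l₂, s', l₃, rfl⟩ := exists_eq_of_not_nodup (not_nodup_of_total_eq_zero hl h)
  obtain ⟨S₁, T₁, r₁, L₁, a₁, b₁, c₁⟩ :=
    moveTokens_complete (i := 0) (j := 2) (by simp) (by simp) l₁ _ hT h₀
  obtain ⟨S₂, T₂, r₂, L₂, a₂, b₂, c₂⟩ :=
    moveTokens_complete (i := 0) (j := 1) (by simp) (by simp) [(x, s)] _ L₁ a₁
  obtain ⟨S₃, T₃, r₃, L₃, a₃, b₃, c₃⟩ :=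
    moveTokens_complete (i := 0) (j := 2) (by simp) (by simp) l₂ _ L₂ a₂
  have e₁ : T₃ 1 = [(x, s)] := by
    rw [c₃ 1 (by simp) (by simp), b₂, c₁ 1 (by simp) (by simp), h₁]
    rfl
  have e₂ : T₃ 2 = l₂.reverse ++ l₁.reverse := by
    rw [b₃, c₂ 2 (by simp) (by simp), b₁, h₂, List.append_nil]
  -- Here `l₄` is what remains of the pair: one token with an extra tick if the signs agree, nothing
  -- if they differ. It is no longer than the pair, so the ledger does not grow.
  obtain ⟨S₄, T₄, l₄, r₄, L₄, a₄, b₄, c₄, d₄, e₄, f₄⟩ :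
      ∃ S₄ T₄ l₄, Runs reduceStep.star (5 * x.length + 5) S₃ S₄ ∧ Ledger S₄ T₄ ∧
        T₄ 0 = l₄ ++ l₃ ∧ T₄ 1 = [] ∧ T₄ 2 = l₂.reverse ++ l₁.reverse ∧ l₄.length < 2 ∧
        (enc l₄).length ≤ 2 * x.length + 2 ∧
        ∀ v, IsVal v → total v l₄ = sign s * v x + sign s' * v x := by
    rcases eq_or_ne s' s with rfl | hs
    · obtain ⟨S₄, r, L⟩ := merge_complete L₃ a₃ e₁
      refine ⟨S₄, _, [(.tick :: x, s')], Runs.star_single (runs_anyOf.2 ⟨_, by simp, r⟩), L,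
        by simp, by simp, by simp [e₂], by simp, by simp [enc]; omega, fun v hv => ?_⟩
      simp [total, hv x]; ring
    · obtain rfl : s = !s' := by revert hs; cases s <;> cases s' <;> simp
      obtain ⟨S₄, r, L⟩ := cancel_complete L₃ a₃ e₁
      refine ⟨S₄, _, [], Runs.star_single ((runs_anyOf.2 ⟨_, by simp, r⟩).mono (by omega)), L,
        by simp, by simp, by simp [e₂], by simp, by simp [enc], fun v _ => ?_⟩
      cases s' <;> simp [total, sign]
  obtain ⟨S₅, T₅, r₅, L₅, a₅, b₅, c₅⟩ :=
    moveTokens_complete (i := 2) (j := 0) (by simp) (by simp) (l₂.reverse ++ l₁.reverse) [] L₄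
      (by rw [c₄, List.append_nil])
  refine ⟨S₅, T₅, _, (Runs.star_trans r₁ (Runs.star_trans r₂ (Runs.star_trans r₃
    (Runs.star_trans r₄ r₅)))).mono ?_, L₅, b₅, ?_, a₅, ?_, ?_, fun v hv => ?_⟩
  · simp only [length_enc_append, length_enc_reverse, enc_cons, List.length_append,
      List.length_cons, enc_nil, List.length_nil]
    omega
  · rw [c₅ 1 (by simp) (by simp), b₄]
  · simp only [a₄, List.reverse_append, List.reverse_reverse, List.length_append,
      List.length_cons]
    omega
  · simp only [a₄, length_enc_append, length_enc_reverse, enc_cons, List.length_append,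
      List.length_cons]
    omega
  · rw [← h v hv, a₄]
    simp only [total_append, total_reverse, total_cons, f₄ v hv]
    ring

theorem reduce_complete (D : ℕ) {l : List Token} (hT : Ledger S T) (h₀ : T 0 = l)
    (h₁ : T 1 = []) (h₂ : T 2 = []) (hD : (enc l).length ≤ D)
    (h : ∀ v, IsVal v → total v l = 0) :
    ∃ S', Runs reduceStep.star (l.length * (10 * D)) S S' ∧ ∀ i, S' (.ledger i) = [] := by
  induction hn : l.length using Nat.strong_induction_on generalizing S T l with
  | _ n ih =>
    subst hn
    rcases eq_or_ne l [] with rfl | hl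
    · refine ⟨S, .star_refl, fun i => ?_⟩
      rw [hT.stack i]
      fin_cases i <;> simp [h₀, h₁, h₂, enc]
    · obtain ⟨S₁, T₁, l', r, L, e₀, e₁, e₂, hlt, hle, h'⟩ :=
        reduceStep_complete hT h₀ h₁ h₂ hl h
      obtain ⟨S', r', hS'⟩ := ih _ hlt L e₀ e₁ e₂ (hle.trans hD) h' rfl
      refine ⟨S', (Runs.star_trans r r').mono ?_, hS'⟩
      calc 10 * (enc l).length + l'.length * (10 * D) ≤ (l'.length + 1) * (10 * D) := by
            rw [Nat.add_mul]; omega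
        _ ≤ l.length * (10 * D) := Nat.mul_le_mul_right _ hlt

end Verifier

end Arrival

namespace Arrival

namespace SwitchGraph

variable {V : Type*} [DecidableEq V] (G : SwitchGraph V) {o d : V}

/-! ### Visits of the train to the vertices -/

/-- The number of visits to the vertex `v` before the `k`-th step. -/
def visits (o : V) (k : ℕ) (v : V) : ℕ :=
  ((Finset.range k).filter fun j => (G.runState o j).loc = v).card

@[simp] theorem visits_zero (o v : V) : G.visits o 0 v = 0 := by simp [visits]

theorem visits_succ (o : V) (k : ℕ) (v : V) :
    G.visits o (k + 1) v = G.visits o k v + if (G.runState o k).loc = v then 1 else 0 := by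
  rw [visits, Finset.range_add_one, Finset.filter_insert]
  split_ifs with h
  · rw [Finset.card_insert_of_notMem (by simp), visits]
  · rw [visits, add_zero]

theorem runState_succ (o : V) (k : ℕ) : G.runState o (k + 1) = loopBody (G.runState o k) :=
  Function.iterate_succ_apply' ..

/-- Each visit swaps the two successors, so the parity of the number of visits determines the
switch. -/
theorem curr_next_eq (o : V) (k : ℕ) (u : V) :
    (G.runState o k).curr u = (if Even (G.visits o k u) then G.s₀ u else G.s₁ u) ∧
      (G.runState o k).next u = if Even (G.visits o k u) then G.s₁ u else G.s₀ u := by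
  induction k with
  | zero => simp [runState]
  | succ k ih =>
    rw [visits_succ, runState_succ, loopBody]
    rcases eq_or_ne (G.runState o k).loc u with rfl | h
    · simp only [Function.update_self, ih, if_true, Nat.even_add_one]
      split_ifs <;> simp_all
    · simpa [h, h.symm] using ih

theorem loc_succ (o : V) (k : ℕ) : (G.runState o (k + 1)).loc =
    if Even (G.visits o k (G.runState o k).loc) then G.s₀ (G.runState o k).loc
      else G.s₁ (G.runState o k).loc := by
  rw [runState_succ, ← (G.curr_next_eq o k _).1, loopBody]

variable [Fintype V]

/-- The number of trains that enter `v` when `t u` trains leave each vertex `u`. -/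
def inflow (t : V → ℕ) (v : V) : ℕ :=
  ∑ u, ((if G.s₀ u = v then (t u + 1) / 2 else 0) + if G.s₁ u = v then t u / 2 else 0)

/-- The flow equations for the numbers `t v` of trains that leave the vertices. -/
def IsVisits (o d : V) (t : V → ℕ) : Prop :=
  ∀ v, t v + (if v = d then 1 else 0) = (if v = o then 1 else 0) + G.inflow t v

theorem inflow_mono {t t' : V → ℕ} (h : ∀ v, t v ≤ t' v) (v : V) :
    G.inflow t v ≤ G.inflow t' v := by
  refine Finset.sum_le_sum fun u _ => ?_
  have := h u
  split_ifs <;> omega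

/-- Flow conservation during the run, with the current location in the role of the destination. -/
theorem visits_add_loc (o : V) (k : ℕ) (v : V) :
    G.visits o k v + (if v = (G.runState o k).loc then 1 else 0) =
      (if v = o then 1 else 0) + G.inflow (G.visits o k) v := by
  induction k with
  | zero =>
    simp only [visits_zero, inflow, Nat.zero_div, zero_add, Nat.reduceDiv, ite_self,
      Finset.sum_const_zero, add_zero]
    rfl
  | succ k ih =>
    have hne : ∀ u ≠ (G.runState o k).loc, G.visits o (k + 1) u = G.visits o k u := fun u hu => by
      rw [visits_succ, if_neg hu.symm, add_zero]
    -- Only the summand of the current location changes. The parity of its visits decides which of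
    -- its two halves grows by one, in agreement with `loc_succ`.
    have h : G.inflow (G.visits o (k + 1)) v =
        G.inflow (G.visits o k) v + if v = (G.runState o (k + 1)).loc then 1 else 0 := by
      rw [inflow, inflow, Fintype.sum_eq_add_sum_compl (G.runState o k).loc,
        Fintype.sum_eq_add_sum_compl (G.runState o k).loc,
        Finset.sum_congr rfl fun u hu => by rw [hne u (by simpa using hu)], loc_succ, visits_succ]
      generalize (G.runState o k).loc = w
      rcases Nat.even_or_odd' (G.visits o k w) with ⟨m, hm | hm⟩ <;>
        simp only [hm, if_true, eq_comm (a := v), even_two_mul, Nat.not_even_bit1] <;>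
        split_ifs <;> simp_all <;> omega
    rw [h, visits_succ, ← add_assoc, ← ih]
    simp only [eq_comm (a := v)]

theorem sum_visits (o : V) (k : ℕ) : ∑ v, G.visits o k v = k := by
  simpa [visits] using (Finset.card_eq_sum_card_fiberwise (s := Finset.range k)
    (f := fun j => (G.runState o j).loc) (t := Finset.univ) (by simp)).symm

/-- A solution `t` may contain superfluous circulations, yet it dominates the visit counts of a run
that has not reached `d`. If the train is at `v ≠ d`, its visits plus one equal the inflow so far
plus the unit at `o`; by monotonicity this is at most `t v`. -/
theorem IsVisits.terminates {G : SwitchGraph V} {t : V → ℕ} (ht : G.IsVisits o d t) :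
    G.Terminates o d := by
  by_contra h
  have h : ∀ k, (G.runState o k).loc ≠ d := fun k hk => h ⟨k, hk⟩
  have hle : ∀ k v, G.visits o k v ≤ t v := by
    intro k
    induction k with
    | zero => simp [visits]
    | succ k ih =>
      intro v
      rw [visits_succ]
      split_ifs with hv
      · have h₁ := G.visits_add_loc o k v
        have h₂ := G.inflow_mono ih v
        have h₃ := ht v
        rw [if_pos hv.symm] at h₁
        rw [if_neg (hv ▸ h k)] at h₃
        omega
      · exact ih v
  -- After `∑ v, t v + 1` steps the visit counts add up to more than `t` allows.
  have := Finset.sum_le_sum fun v (_ : v ∈ Finset.univ) => hle (∑ v, t v + 1) v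
  rw [sum_visits] at this
  omega

omit [Fintype V] in
theorem loc_runLength {G : SwitchGraph V} (h : G.Terminates o d) :
    (G.runState o (G.runLength o d)).loc = d := Nat.sInf_mem h

theorem isVisits_visits {G : SwitchGraph V} (h : G.Terminates o d) :
    G.IsVisits o d (G.visits o (G.runLength o d)) := by
  intro v
  rw [← visits_add_loc, loc_runLength h]

omit [Fintype V] in
theorem runState_add (o : V) (k m : ℕ) : G.runState o (m + k) = loopBody^[m] (G.runState o k) :=
  Function.iterate_add_apply ..

theorem runLength_le {G : SwitchGraph V} (h : G.Terminates o d) :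
    G.runLength o d ≤ Fintype.card V * 2 ^ Fintype.card V := by
  -- Location and parities determine the state, and they take at most `n * 2 ^ n` values.
  have hinj : Set.InjOn (fun k => ((G.runState o k).loc, fun u => decide (Even (G.visits o k u))))
      (Finset.range (G.runLength o d)) := by
    -- Cutting out the loop between two equal states would reach `d` earlier than `runLength`.
    have key : ∀ i j, i < j → j < G.runLength o d → G.runState o i ≠ G.runState o j := by
      intro i j hij hj he
      have h₁ := loc_runLength h
      rw [show G.runLength o d = (G.runLength o d - j) + j by omega, runState_add, ← he,
        ← runState_add] at h₁
      have : G.runLength o d ≤ G.runLength o d - j + i := Nat.sInf_le h₁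
      omega
    intro i hi j hj he
    simp only [Prod.mk.injEq, funext_iff, decide_eq_decide] at he
    have he' : G.runState o i = G.runState o j := by
      have h₁ : (G.runState o i).curr = (G.runState o j).curr := funext fun u => by
        simp only [curr_next_eq, he.2 u]
      have h₂ : (G.runState o i).next = (G.runState o j).next := funext fun u => by
        simp only [curr_next_eq, he.2 u]
      have h₃ := he.1
      revert h₁ h₂ h₃
      rcases G.runState o i with ⟨_, _, _⟩
      rcases G.runState o j with ⟨_, _, _⟩
      simp +contextual
    simp only [Finset.coe_range, Set.mem_Iio] at hi hj
    rcases lt_trichotomy i j with hij | hij | hij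
    · exact absurd he' (key i j hij hj)
    · exact hij
    · exact absurd he'.symm (key j i hij hi)
  have := Finset.card_le_card_of_injOn _ (fun _ _ => Finset.mem_univ _) hinj
  simpa using this

/-! ### Switching flows -/

/-- The edges that leave `v` are traversed alternately, beginning with the even successor, `t v`
times in total. -/
def IsSplit (t : V → ℕ) (x : G.edges → ℕ) : Prop :=
  ∀ u, (G.s₀ u = G.s₁ u → x (G.evenEdge u) = t u) ∧
    (G.s₀ u ≠ G.s₁ u → x (G.evenEdge u) = (t u + 1) / 2 ∧ x (G.oddEdge u) = t u / 2)

variable {G} {t : V → ℕ} {x : G.edges → ℕ}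

theorem eq_evenEdge_or_oddEdge (e : G.edges) :
    e = G.evenEdge e.1.1 ∨ e = G.oddEdge e.1.1 := by
  obtain ⟨⟨u, w⟩, he⟩ := e
  simp only [edges, Finset.mem_union, Finset.mem_image, Finset.mem_univ, true_and,
    Prod.mk.injEq] at he
  rcases he with ⟨_, rfl, rfl⟩ | ⟨_, rfl, rfl⟩
  exacts [Or.inl rfl, Or.inr rfl]

/-- If both successors coincide there is only one outgoing edge, which must not be counted twice. -/
theorem sum_outgoing (f : G.edges → ℕ) (u : V) :
    ∑ e : G.edges with e.1.1 = u, f e =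
      f (G.evenEdge u) + if G.s₀ u = G.s₁ u then 0 else f (G.oddEdge u) := by
  have h : (Finset.univ.filter fun e : G.edges => e.1.1 = u) = {G.evenEdge u, G.oddEdge u} := by
    ext e
    simp only [Finset.mem_filter, Finset.mem_univ, true_and, Finset.mem_insert,
      Finset.mem_singleton]
    constructor
    · rintro rfl
      exact eq_evenEdge_or_oddEdge e
    · rintro (rfl | rfl) <;> rfl
  rw [h]
  split_ifs with hs
  · have : G.oddEdge u = G.evenEdge u := Subtype.ext (by simp [oddEdge, evenEdge, hs])
    rw [this]; simp
  · exact Finset.sum_pair fun he => hs (Prod.ext_iff.1 (Subtype.ext_iff.1 he)).2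

theorem IsSplit.sum_outgoing (h : G.IsSplit t x) (u : V) :
    ∑ e : G.edges with e.1.1 = u, x e = t u := by
  rw [SwitchGraph.sum_outgoing]
  have := h u
  split_ifs with hs <;> simp_all
  omega

theorem IsSplit.sum_incoming (h : G.IsSplit t x) (v : V) :
    ∑ e : G.edges with e.1.2 = v, x e = G.inflow t v := by
  rw [Finset.sum_filter, ← Finset.sum_fiberwise_of_maps_to (g := fun e : G.edges => e.1.1)
    (t := Finset.univ) (by simp)]
  refine Finset.sum_congr rfl fun u _ => ?_
  rw [SwitchGraph.sum_outgoing]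
  have h := h u
  simp only [evenEdge, oddEdge] at h ⊢
  by_cases hs : G.s₀ u = G.s₁ u
  · simp only [hs, true_implies, if_true] at h ⊢
    split_ifs <;> omega
  · simp [hs, h]

theorem IsSplit.isSwitchingFlow_iff (h : G.IsSplit t x) (hod : o ≠ d) :
    G.IsSwitchingFlow o d x ↔ G.IsVisits o d t := by
  refine forall_congr' fun v => ?_
  have h₁ : (∑ e : G.edges with e.1.1 = v, (x e : ℤ)) = (t v : ℤ) := by
    rw [← h.sum_outgoing v]; simp
  have h₂ : (∑ e : G.edges with e.1.2 = v, (x e : ℤ)) = (G.inflow t v : ℤ) := by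
    rw [← h.sum_incoming v]; simp
  have h₃ : x (G.oddEdge v) ≤ x (G.evenEdge v) ∧ x (G.evenEdge v) ≤ x (G.oddEdge v) + 1 := by
    by_cases hs : G.s₀ v = G.s₁ v
    · have : G.oddEdge v = G.evenEdge v := Subtype.ext (by simp [oddEdge, evenEdge, hs])
      rw [this]; simp
    · have := (h v).2 hs
      omega
  rw [h₁, h₂, and_iff_left h₃]
  by_cases hv : v = o
  · subst hv; simp [hod]; omega
  · by_cases hv' : v = d
    · subst hv'; simp [hv]; omega
    · simp [hv, hv']; omega

/-- The balancing condition leaves only one way to divide a given outflow between two distinct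
edges. -/
theorem IsSwitchingFlow.isSplit (h : G.IsSwitchingFlow o d x) :
    G.IsSplit (fun u => ∑ e : G.edges with e.1.1 = u, x e) x := by
  intro u
  have := (h u).2
  simp only [sum_outgoing]
  refine ⟨fun hs => by simp [hs], fun hs => ?_⟩
  simp only [hs, if_false]
  omega

theorem isSplit_runProfile (G : SwitchGraph V) (o d : V) :
    G.IsSplit (G.visits o (G.runLength o d)) (G.runProfile o d) := by
  intro u
  have hp : ∀ (P : ℕ → Prop) [DecidablePred P] (k : ℕ), ((Finset.range (k + 1)).filter P).card =
      ((Finset.range k).filter P).card + if P k then 1 else 0 := by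
    intro P _ k
    rw [Finset.range_add_one, Finset.filter_insert]
    split_ifs <;> simp
  constructor <;> intro hs <;> simp only [runProfile, evenEdge, oddEdge, Prod.mk.injEq]
  · refine congrArg _ (Finset.filter_congr fun k _ => and_iff_left_of_imp ?_)
    rintro rfl
    rw [loc_succ]
    split_ifs <;> simp [hs]
  · induction G.runLength o d with
    | zero => simp [visits]
    | succ k ih =>
      rw [hp, hp, visits_succ, ih.1, ih.2, loc_succ]
      by_cases hu : (G.runState o k).loc = u
      · subst hu
        rcases Nat.even_or_odd' (G.visits o k (G.runState o k).loc) with ⟨m, hm | hm⟩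
        · simp [hm, hs]; omega
        · simp [hm, Ne.symm hs]; omega
      · simp [hu]

theorem terminates_iff_exists_isSwitchingFlow (hod : o ≠ d) :
    G.Terminates o d ↔ ∃ x, G.IsSwitchingFlow o d x :=
  ⟨fun h => ⟨_, ((isSplit_runProfile G o d).isSwitchingFlow_iff hod).2 (isVisits_visits h)⟩,
    fun ⟨_, hx⟩ => ((hx.isSplit.isSwitchingFlow_iff hod).1 hx).terminates⟩

theorem isSwitchingFlow_runProfile (hod : o ≠ d) (h : G.Terminates o d) :
    G.IsSwitchingFlow o d (G.runProfile o d) :=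
  ((isSplit_runProfile G o d).isSwitchingFlow_iff hod).2 (isVisits_visits h)

theorem runProfile_le (h : G.Terminates o d) (e : G.edges) :
    G.runProfile o d e ≤ Fintype.card V * 2 ^ Fintype.card V :=
  (Finset.card_filter_le _ _).trans (by simpa using runLength_le h)

/-- The form used by the verifier. It covers `o = d` as well, and its bound keeps the counts within
polynomially many bits. -/
theorem terminates_iff_exists_isVisits : G.Terminates o d ↔
    ∃ t, G.IsVisits o d t ∧ ∀ v, t v ≤ Fintype.card V * 2 ^ Fintype.card V :=
  ⟨fun h => ⟨_, isVisits_visits h, fun _ =>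
    (Finset.card_filter_le _ _).trans (by simpa using runLength_le h)⟩,
    fun ⟨_, h, _⟩ => h.terminates⟩

end SwitchGraph

end Arrival

/-! ### The complete verifier: reading the input, filling and emptying the ledger. -/

namespace Arrival

namespace Verifier

open StackOp Function

variable {S S' S₁ : Reg → List Sym} {t : ℕ} {φ : (List Sym → ℤ) → ℤ} {v : List Sym → ℤ}
  {T : Fin 3 → List Token} {w : List (Option Bool)} {a b : List Bool} {c : List Sym}
  {D D' : ℕ → VertexData} {n : ℕ}

/-- The symbols of the input. -/
def inputSym : Option Bool → Sym
  | some b => .bit b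
  | none => .sep

/-- The stacks at the beginning. -/
def initial (w : List (Option Bool)) : Reg → List Sym :=
  update (fun _ => []) .rev (w.map inputSym).reverse

/-- Read origin and destination. -/
def setup : RegularExpression (StackOp Reg Sym) :=
  scan [.bit false, .bit true, .sep] [.rev] id [.inp] * word [.empty .rev] *
    readNum .fst * emit .fst 0 true [] * emit .fst 0 true [.star] *
    readNum .fst * emit .fst 0 false [] * emit .fst 0 true [.star]

/-- The stacks after origin `a` and destination `b` have been read. -/
structure IsSetup (w : List (Option Bool)) (a b : List Bool) (S : Reg → List Sym) : Prop where
  inp : w.map inputSym = name a ++ .sep :: (name b ++ .sep :: S .inp)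
  ctr : S .ctr = []
  fst : S .fst = name b
  snd : S .snd = []
  tmp : S .tmp = []
  value : HasValue S fun v =>
    v (name a) - v (name b) + (v (.star :: name a) + v (.star :: name b))

theorem hasValue_zero (h : S .tmp = []) (h' : ∀ i, S (.ledger i) = []) : HasValue S fun _ => 0 :=
  ⟨fun _ => [], ⟨h, fun i => by rw [h' i]; rfl, by simp⟩, fun v _ => by simp [total]⟩

theorem setup_sound (h : Runs setup t (initial w) S) : ∃ a b, IsSetup w a b S := by
  obtain ⟨S₇, h, h₈⟩ := runs_mul h
  obtain ⟨S₆, h, h₇⟩ := runs_mul h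
  obtain ⟨S₅, h, h₆⟩ := runs_mul h
  obtain ⟨S₄, h, h₅⟩ := runs_mul h
  obtain ⟨S₃, h, h₄⟩ := runs_mul h
  obtain ⟨S₂, h, h₃⟩ := runs_mul h
  obtain ⟨S₁, h₁, h₂⟩ := runs_mul h
  obtain ⟨x, -, h₁⟩ := runs_scan (by simp) h₁
  simp only [runs_word, exec_nil, exec_empty] at h₂
  obtain ⟨-, h₂, rfl⟩ := h₂
  have e₁ := h₁.source .rev (by simp)
  have e₂ := h₁.target .inp (by simp)
  rw [h₂] at e₁
  obtain rfl : (w.map inputSym).reverse = x := by simpa [initial] using e₁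
  have i₁ : S₁ .inp = w.map inputSym := by simpa [initial] using e₂
  have f₁ : ∀ k, k ≠ .rev → k ≠ .inp → S₁ k = [] := fun k hk hk' => by
    rw [h₁.frame k (by simpa using hk) (by simpa using hk')]; simp [initial, hk]
  have v₁ : HasValue S₁ fun _ => 0 := hasValue_zero (f₁ _ (by simp) (by simp))
    fun i => f₁ _ (by simp) (by simp)
  obtain ⟨a, ha, e₃⟩ := readNum_sound (by simp) (by simp) v₁.tmp h₃
  have v₃ : HasValue S₃ fun _ => 0 := v₁.of_eq (by rw [e₃]; simpa using v₁.tmp)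
    fun i => by rw [e₃]; simp
  have a₃ : S₃ .fst = name a := by rw [e₃]; simp
  obtain rfl := emit_sound (by simp) (by simp) v₃.tmp a₃ h₄
  have g₄ := emits_name (S := S₃) 0 a true
  obtain rfl := emit_sound (by simp) (by simp) ((g₄.frame _ (by simp)).trans v₃.tmp)
    ((g₄.frame _ (by simp)).trans a₃) h₅
  have g₅ := g₄.trans (emits_star_name 0 a true)
  have v₅ := g₅.value _ v₃
  obtain ⟨b, hb, e₆⟩ := readNum_sound (by simp) (by simp) v₅.tmp h₆
  have v₆ := v₅.of_eq (S' := S₆) (by rw [e₆]; simpa using v₅.tmp) fun i => by rw [e₆]; simp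
  have b₆ : S₆ .fst = name b := by rw [e₆]; simp
  obtain rfl := emit_sound (by simp) (by simp) v₆.tmp b₆ h₇
  have g₇ := emits_name (S := S₆) 0 b false
  obtain rfl := emit_sound (by simp) (by simp) ((g₇.frame _ (by simp)).trans v₆.tmp)
    ((g₇.frame _ (by simp)).trans b₆) h₈
  have g₈ := g₇.trans (emits_star_name 0 b true)
  have v₈ := g₈.value _ v₆
  have h₆' : ∀ k, k ≠ .inp → k ≠ .fst → (∀ i, k ≠ .ledger i) → S₆ k = S₁ k := by
    intro k hk hk' hk''
    rw [e₆, update_of_ne hk', update_of_ne hk, g₅.frame k hk'', e₃, update_of_ne hk',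
      update_of_ne hk]
  refine ⟨a, b, ?_, ?_, ?_, ?_, v₈.tmp, v₈.congr fun v _ => ?_⟩
  · rw [g₈.frame _ (by simp), ← i₁, ha, ← hb, g₅.frame _ (by simp)]
  · rw [g₈.frame _ (by simp), h₆' _ (by simp) (by simp) (by simp), f₁ _ (by simp) (by simp)]
  · rw [g₈.frame _ (by simp), b₆]
  · rw [g₈.frame _ (by simp), h₆' _ (by simp) (by simp) (by simp), f₁ _ (by simp) (by simp)]
  · simp [sign]; ring

theorem setup_complete (hw : w.map inputSym = name a ++ .sep :: (name b ++ .sep :: c)) :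
    ∃ S, Runs setup (40 * (w.length + 1)) (initial w) S ∧ IsSetup w a b S ∧ S .inp = c := by
  have hl : a.length + b.length + 2 + c.length = w.length := by
    have := congrArg List.length hw
    simp at this
    omega
  have h₁ : Scan [.rev] id [.inp] (w.map inputSym).reverse (initial w)
      (update (fun _ => []) .inp (w.map inputSym)) := by
    refine ⟨by simp [initial], by simp [initial], fun k hk hk' => ?_⟩
    simp only [List.mem_singleton] at hk hk'
    simp [initial, hk, hk']
  have h₁ := h₁.runs (F := [.bit false, .bit true, .sep]) (by simp) (by
    intro x hx
    obtain ⟨y, -, rfl⟩ := List.mem_map.1 (List.mem_reverse.1 hx)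
    rcases y with _ | _ | _ <;> simp [inputSym])
  have h₂ := h₁.mul (runs_word (c := [.empty .rev]).2
    ⟨le_rfl, exec_empty.2 ⟨by simp, exec_nil.2 rfl⟩⟩)
  have h₃ := h₂.mul (readNum_complete (X := .fst) (z := []) (by simp) (by simp) (by simp)
    (by simp [name]) (by rw [update_self, hw]))
  obtain ⟨S₃, e₃⟩ : ∃ S₃ : Reg → List Sym, S₃ =
    update (update (update (fun _ => []) .inp (w.map inputSym)) .inp (name b ++ .sep :: c)) .fst (name a) := ⟨_, rfl⟩
  rw [← e₃] at h₃
  have v₃ : HasValue S₃ fun _ => 0 := hasValue_zero (by simp [e₃]) fun i => by simp [e₃]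
  have a₃ : S₃ .fst = name a := by simp [e₃]
  have h₄ := h₃.mul (emit_complete 0 true [] (by simp) (by simp) v₃.tmp a₃)
  have g₄ := emits_name (S := S₃) 0 a true
  have h₅ := h₄.mul (emit_complete (X := .fst) (x := a) 0 true [.star] (by simp) (by simp)
    ((g₄.frame _ (by simp)).trans v₃.tmp) ((g₄.frame _ (by simp)).trans a₃))
  have g₅ := g₄.trans (emits_star_name 0 a true)
  have v₅ := g₅.value _ v₃
  have h₆ := h₅.mul (readNum_complete (X := .fst) (z := a) (x := b) (r := c) (by simp) (by simp)
    v₅.tmp ((g₅.frame _ (by simp)).trans a₃) ((g₅.frame _ (by simp)).trans (by simp [e₃])))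
  obtain ⟨S₆, e₆⟩ : ∃ S₆ : Reg → List Sym, S₆ =
    update (update (addToken 0 ([Sym.star].reverse ++ name a) true
      (addToken 0 (([] : List Sym).reverse ++ name a) true S₃)) .inp c) .fst (name b) := ⟨_, rfl⟩
  rw [← e₆] at h₆
  have v₆ := v₅.of_eq (S' := S₆) (by rw [e₆]; simpa using v₅.tmp) fun i => by rw [e₆]; simp
  have b₆ : S₆ .fst = name b := by rw [e₆]; simp
  have h₇ := h₆.mul (emit_complete 0 false [] (by simp) (by simp) v₆.tmp b₆)
  have g₇ := emits_name (S := S₆) 0 b false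
  have h₈ := h₇.mul (emit_complete (X := .fst) (x := b) 0 true [.star] (by simp) (by simp)
    ((g₇.frame _ (by simp)).trans v₆.tmp) ((g₇.frame _ (by simp)).trans b₆))
  have g₈ := g₇.trans (emits_star_name 0 b true)
  have v₈ := g₈.value _ v₆
  have i₈ := (g₈.frame .inp (by simp)).trans (show S₆ .inp = c by simp [e₆])
  refine ⟨_, h₈.mono ?_, ⟨by rw [hw, i₈], ?_, ?_, ?_, v₈.tmp, v₈.congr fun v _ => ?_⟩, i₈⟩
  · simp; omega
  · rw [g₈.frame _ (by simp)]; simp [e₆, e₃]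
  · rw [g₈.frame _ (by simp), b₆]
  · rw [g₈.frame _ (by simp)]; simp [e₆, e₃]
  · simp [sign]; ring

/-- The part of the input that belongs to a vertex. -/
def block (d : VertexData) : List Sym := name d.a ++ .sep :: (name d.b ++ [.sep])

/-- The effect of the program `vertex` for the first `n` vertices. -/
structure VertexSteps (D : ℕ → VertexData) (n : ℕ) (S S' : Reg → List Sym) : Prop where
  rem : ∀ u < n, (D u).r ≤ 1
  inp : S .inp = (List.range n).flatMap (fun u => block (D u)) ++ S' .inp
  ctr : S' .ctr = name n.bits
  tmp : S' .tmp = []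
  value : ∀ φ, HasValue S φ →
    HasValue S' fun v => φ v + ∑ u ∈ Finset.range n, (D u).value u.bits v

/-- An empty counter represents vertex 0, because `Nat.bits 0` is the empty list. -/
theorem VertexSteps.zero (D : ℕ → VertexData) (hc : S .ctr = []) (ht : S .tmp = []) :
    VertexSteps D 0 S S :=
  ⟨by simp, by simp, by simp [hc, name], ht, fun φ h => by simpa using h⟩

theorem VertexSteps.succ (h : VertexSteps D n S S₁) (h' : VertexStep n.bits (D n) S₁ S') :
    VertexSteps D (n + 1) S S' := by
  refine ⟨fun u hu => ?_, ?_, ?_, h'.tmp, fun φ hφ => (h'.value _ (h.value φ hφ)).congr ?_⟩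
  · rcases Nat.lt_succ_iff_lt_or_eq.1 hu with hu | rfl
    exacts [h.rem u hu, h'.rem]
  · rw [h.inp, h'.inp, List.range_succ, List.flatMap_append]
    simp [block]
  · rw [h'.ctr, bits_succ]
  · intro v _
    rw [Finset.sum_range_succ, add_assoc]

theorem VertexSteps.congr (h : VertexSteps D n S S') (hD : ∀ u < n, D u = D' u) :
    VertexSteps D' n S S' := by
  refine ⟨fun u hu => hD u hu ▸ h.rem u hu, ?_, h.ctr, h.tmp, fun φ hφ =>
    (h.value φ hφ).congr fun v _ => ?_⟩
  · rw [h.inp]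
    congr 1
    exact List.flatMap_congr fun u hu => by rw [hD u (List.mem_range.1 hu)]
  · rw [Finset.sum_congr rfl fun u hu => by rw [hD u (Finset.mem_range.1 hu)]]

theorem vertices_sound (hc : S .ctr = []) (ht : S .tmp = []) (h : Runs vertex.star t S S') :
    ∃ D n, VertexSteps D n S S' := by
  replace h := runs_star h
  induction h with
  | refl => exact ⟨fun _ => ⟨[], [], 0, 0, 0⟩, 0, .zero _ hc ht⟩
  | tail _ h ih =>
    obtain ⟨D, n, ih⟩ := ih
    obtain ⟨d, hd⟩ := vertex_sound ih.tmp ih.ctr h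
    refine ⟨update D n d, n + 1, .succ (ih.congr fun u hu => ?_) (by rwa [update_self])⟩
    rw [update_of_ne hu.ne]

theorem vertices_complete (B K : ℕ) (hc : S .ctr = []) (ht : S .tmp = []) {z z' : List Bool}
    (hz : S .fst = name z) (hz' : S .snd = name z') (hzB : z.length ≤ B) (hzB' : z'.length ≤ B)
    (hi : S .inp = (List.range n).flatMap (fun u => block (D u)) ++ c)
    (hD : ∀ u < n, u.bits.length ≤ B ∧ (D u).a.length ≤ B ∧ (D u).b.length ≤ B ∧
      (D u).k ≤ K ∧ (D u).h < 2 ^ B ∧ (D u).r ≤ 1) :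
    ∃ S', Runs vertex.star (n * (5 * K * (B + 1) + 44 * (B + 1) ^ 2)) S S' ∧
      VertexSteps D n S S' ∧ ∃ z z', S' .fst = name z ∧ S' .snd = name z' ∧
        z.length ≤ B ∧ z'.length ≤ B := by
  induction n generalizing c with
  | zero => exact ⟨S, .star_refl, .zero D hc ht, z, z', hz, hz', hzB, hzB'⟩
  | succ n ih =>
    rw [List.range_succ, List.flatMap_append, List.append_assoc] at hi
    obtain ⟨S₁, h, hs, z, z', hz, hz', hzB, hzB'⟩ := ih hi fun u hu => hD u (by omega)
    obtain ⟨b₁, b₂, b₃, b₄, b₅, b₆⟩ := hD n (by omega)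
    obtain ⟨S', h', hs'⟩ := vertex_complete B (c := c) hs.tmp (D n) hs.ctr hz hz' (by
      have := List.append_cancel_left (hs.inp.symm.trans hi)
      simpa [block] using this) ⟨b₁, hzB, hzB', b₂, b₃⟩ b₅ b₆
    refine ⟨S', (h.star_trans h'.star_single).mono ?_, hs.succ hs', _, _, hs'.fst, hs'.snd, b₂, b₃⟩
    have : 5 * (D n).k * (B + 1) ≤ 5 * K * (B + 1) := by gcongr
    rw [Nat.add_mul]
    omega

/-- The verifier. -/
def verifier : RegularExpression (StackOp Reg Sym) :=
  setup * vertex.star * word [.empty .inp] * reduceStep.star *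
    word [.empty (.ledger 0), .empty (.ledger 1), .empty (.ledger 2)]

theorem verifier_sound (h : Runs verifier t (initial w) S') :
    ∃ (a b : List Bool) (D : ℕ → VertexData) (n : ℕ), (∀ u < n, (D u).r ≤ 1) ∧
      w.map inputSym = name a ++ .sep :: (name b ++ .sep ::
        (List.range n).flatMap fun u => block (D u)) ∧
      ∀ v, IsVal v → v (name a) - v (name b) + (v (.star :: name a) + v (.star :: name b)) +
        ∑ u ∈ Finset.range n, (D u).value u.bits v = 0 := by
  obtain ⟨S₄, h, h₅⟩ := runs_mul h
  obtain ⟨S₃, h, h₄⟩ := runs_mul h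
  obtain ⟨S₂, h, h₃⟩ := runs_mul h
  obtain ⟨S₁, h₁, h₂⟩ := runs_mul h
  obtain ⟨a, b, h₁⟩ := setup_sound h₁
  obtain ⟨D, n, h₂⟩ := vertices_sound h₁.ctr h₁.tmp h₂
  simp only [runs_word, exec_nil, exec_empty] at h₃ h₅
  obtain ⟨-, h₃, rfl⟩ := h₃
  have h₄ := (h₂.value _ h₁.value).of_reduceStep_star h₄
  refine ⟨a, b, D, n, h₂.rem, ?_, fun v hv => h₄.eq_zero (fun i => ?_) hv⟩
  · rw [h₁.inp, h₂.inp, h₃, List.append_nil]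
  · fin_cases i
    exacts [h₅.2.1, h₅.2.2.1, h₅.2.2.2.1]

/-- Stacks 1 and 2 are first emptied onto stack 0, as `reduce_complete` requires. This gives at most
`3 * C` symbols there. -/
theorem gather_complete (C : ℕ) (h : HasValue S fun _ => 0)
    (hC : ∀ i, (S (.ledger i)).length ≤ C) :
    ∃ S', Runs reduceStep.star (8 * C + 90 * C ^ 2) S S' ∧ ∀ i, S' (.ledger i) = [] := by
  obtain ⟨T, hT, hv⟩ := h
  obtain ⟨S₁, T₁, r₁, L₁, a₁, b₁, c₁⟩ :=
    moveTokens_complete (i := 1) (j := 0) (by simp) (by simp) (T 1) [] hT (by simp)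
  obtain ⟨S₂, T₂, r₂, L₂, a₂, b₂, c₂⟩ :=
    moveTokens_complete (i := 2) (j := 0) (by simp) (by simp) (T 2) [] L₁
      (by rw [c₁ 2 (by simp) (by simp), List.append_nil])
  have hl : (enc (T₂ 0)).length ≤ 3 * C := by
    have h₀ := hT.stack 0 ▸ hC 0
    have h₁ := hT.stack 1 ▸ hC 1
    have h₂ := hT.stack 2 ▸ hC 2
    simp only [b₂, b₁, length_enc_append, length_enc_reverse]
    omega
  obtain ⟨S', r, hS'⟩ := reduce_complete (3 * C) L₂ rfl (by rw [c₂ 1 (by simp) (by simp), a₁]) a₂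
    hl (by
      intro v hv'
      have := hv v hv'
      beta_reduce at this
      rw [← this, b₂, b₁, Fin.sum_univ_three]
      simp only [total_append, total_reverse]
      ring)
  refine ⟨S', (r₁.star_trans (r₂.star_trans r)).mono ?_, hS'⟩
  have h₁ := hT.stack 1 ▸ hC 1
  have h₂ := hT.stack 2 ▸ hC 2
  have h₃ : (T₂ 0).length * (10 * (3 * C)) ≤ (3 * C) * (10 * (3 * C)) :=
    Nat.mul_le_mul_right _ ((length_le_length_enc _).trans hl)
  calc _ ≤ 4 * C + (4 * C + (3 * C) * (10 * (3 * C))) := by omega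
    _ = _ := by ring

theorem verifier_complete (B K : ℕ) (hB : w.length ≤ B)
    (hw : w.map inputSym = name a ++ .sep :: (name b ++ .sep ::
      (List.range n).flatMap fun u => block (D u)))
    (hD : ∀ u < n, u.bits.length ≤ B ∧ (D u).a.length ≤ B ∧ (D u).b.length ≤ B ∧
      (D u).k ≤ K ∧ (D u).h < 2 ^ B ∧ (D u).r ≤ 1)
    (hv : ∀ v, IsVal v → v (name a) - v (name b) + (v (.star :: name a) + v (.star :: name b)) +
        ∑ u ∈ Finset.range n, (D u).value u.bits v = 0) :
    ∃ S', Runs verifier (100 * (40 * (w.length + 1) +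
      n * (5 * K * (B + 1) + 44 * (B + 1) ^ 2) + 1) ^ 2) (initial w) S' := by
  obtain ⟨S₁, h₁, s₁, i₁⟩ := setup_complete hw
  have hbB : b.length ≤ B := by
    have := congrArg List.length hw
    simp only [List.length_map, List.length_append, length_name, List.length_cons] at this
    omega
  obtain ⟨S₂, h₂, s₂, -⟩ := vertices_complete B K s₁.ctr s₁.tmp s₁.fst (z' := []) s₁.snd hbB
    (by simp) (c := []) (by rw [i₁, List.append_nil]) hD
  have h := h₁.mul h₂
  have i₂ : S₂ .inp = [] := by
    have := s₂.inp
    rw [i₁] at this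
    exact List.self_eq_append_right.1 this
  -- The ledger starts empty, so its size is at most the time used so far.
  obtain ⟨S', h', e'⟩ := gather_complete _ ((s₂.value _ s₁.value).congr hv) fun i => by
    simpa [initial] using h.length_le (.ledger i)
  refine ⟨S', (((h.mul (runs_word.2 ⟨le_rfl, ?_⟩)).mul h').mul (runs_word.2 ⟨le_rfl, ?_⟩)).mono ?_⟩
  · simpa using i₂
  · simp [e']
  · simp only [List.length_cons, List.length_nil]
    generalize 40 * (w.length + 1) + n * (5 * K * (B + 1) + 44 * (B + 1) ^ 2) = C
    nlinarith

end Verifier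

end Arrival

/-! ### Accepting runs of the verifier correspond to terminating instances. -/

namespace Arrival

namespace Verifier

open StackOp Function

instance : Inhabited Sym := ⟨.sep⟩

theorem inputSym_injective : Injective inputSym := by
  rintro (_ | a) (_ | b) h <;> simp_all [inputSym]

theorem bits_injective : Injective Nat.bits := fun j k h =>
  (encodeNumber_append_inj (u := []) (v := []) (by simp [encodeNumber, h])).1

theorem map_encode (I : Instance) {D : ℕ → VertexData}
    (hD : ∀ u : Fin I.n, (D u).a = (I.G.s₀ u).val.bits ∧ (D u).b = (I.G.s₁ u).val.bits) :
    I.encode.map inputSym = name I.o.val.bits ++ .sep :: (name I.d.val.bits ++ .sep ::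
      (List.range I.n).flatMap fun u => block (D u)) := by
  have h : ∀ k, (encodeNumber k).map inputSym = name k.bits ++ [.sep] := by
    intro k
    rw [encodeNumber, List.map_append, List.map_map]
    rfl
  have h' : ∀ u : Fin I.n, block (D u) =
      (encodeNumber (I.G.s₀ u)).map inputSym ++ (encodeNumber (I.G.s₁ u)).map inputSym := by
    intro u
    simp [block, h, hD]
  rw [← List.map_coe_finRange_eq_range, List.flatMap_map]
  simp [Instance.encode, Instance.numbers, h, h', List.flatMap_assoc, List.map_flatMap]

theorem base_name (x : List Bool) : base (name x) = name x := by
  cases x <;> simp [base, name]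

theorem ticks_name (x : List Bool) : ticks (name x) = 0 := by
  cases x <;> simp [ticks, name]

theorem base_star (x : List Sym) : base (.star :: x) = .star :: x := by simp [base]

theorem ticks_star (x : List Sym) : ticks (.star :: x) = 0 := by simp [ticks]

theorem name_ne_star (x : List Bool) (y : List Sym) : name x ≠ .star :: y := by
  cases x <;> simp [name]

theorem units_name (x y : List Bool) : units (name y) (name x) = if x = y then 1 else 0 := by
  simp [units, base_name, ticks_name, name_injective.eq_iff]

theorem units_star (x y : List Bool) :
    units (.star :: name y) (.star :: name x) = if x = y then 1 else 0 := by
  simp [units, base_star, ticks_star, name_injective.eq_iff]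

theorem units_name_star (x y : List Bool) : units (name y) (.star :: name x) = 0 := by
  simp [units, base_star, (name_ne_star y _).symm]

theorem units_star_name (x y : List Bool) : units (.star :: name y) (name x) = 0 := by
  simp [units, base_name, name_ne_star x]

/-- Two families of valuations extract the content of the empty ledger. Units at `.star :: name y`
show that the input is a valid encoding; units at `name v.val.bits` give the flow equation at `v`.
-/
theorem mem_ARRIVAL_of_verifier {w : List (Option Bool)} {t : ℕ} {S' : Reg → List Sym}
    (h : Runs verifier t (initial w) S') : w ∈ ARRIVAL := by
  obtain ⟨a, b, D, n, hr, hw, hv⟩ := verifier_sound h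
  -- Negative units at the starred place of `y` are posted only by a vertex numbered `y`. Without
  -- such a vertex all contributions are nonnegative, so their sum zero rules out any occurrence of
  -- `y`. This excludes numbers that are too large as well as non-canonical binary words.
  have key : ∀ y, (∀ u < n, u.bits ≠ y) → a ≠ y ∧ b ≠ y ∧
      ∀ u < n, (D u).a ≠ y ∧ (D u).b ≠ y := by
    intro y hy
    have h₁ := hv _ (isVal_units (.star :: name y))
    have h₂ : ∀ u ∈ Finset.range n, (D u).value u.bits (units (.star :: name y)) =
        (if (D u).a = y then 1 else 0) + if (D u).b = y then 1 else 0 := by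
      intro u hu
      simp [VertexData.value, units_star, units_star_name, hy u (Finset.mem_range.1 hu)]
    rw [Finset.sum_congr rfl h₂] at h₁
    simp only [units_star, units_star_name, sub_self, zero_add] at h₁
    have h₃ : ∀ u ∈ Finset.range n,
        (0 : ℤ) ≤ (if (D u).a = y then 1 else 0) + if (D u).b = y then 1 else 0 := by
      intro u _
      split_ifs <;> simp
    have h₄ := Finset.sum_nonneg h₃
    refine ⟨fun h => ?_, fun h => ?_, fun u hu => ?_⟩
    · rw [if_pos h] at h₁; split_ifs at h₁ <;> omega
    · rw [if_pos h] at h₁; split_ifs at h₁ <;> omega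
    · have h₅ := Finset.single_le_sum h₃ (Finset.mem_range.2 hu)
      constructor <;> intro h <;> rw [if_pos h] at h₅ <;> split_ifs at h₁ h₅ <;> omega
  have hex : ∀ y, (¬ ∀ u < n, u.bits ≠ y) → ∃ u : Fin n, y = u.val.bits := by
    intro y h
    push Not at h
    obtain ⟨u, hu, h⟩ := h
    exact ⟨⟨u, hu⟩, h.symm⟩
  obtain ⟨o, rfl⟩ := hex a fun h => (key _ h).1 rfl
  obtain ⟨d, rfl⟩ := hex b fun h => (key _ h).2.1 rfl
  choose s₀ hs₀ using fun u : Fin n => hex (D u).a fun h => ((key _ h).2.2 u u.2).1 rfl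
  choose s₁ hs₁ using fun u : Fin n => hex (D u).b fun h => ((key _ h).2.2 u u.2).2 rfl
  refine ⟨⟨n, ⟨s₀, s₁⟩, o, d⟩, List.map_injective_iff.2 inputSym_injective ?_, ?_⟩
  · rw [hw]
    exact map_encode ⟨n, ⟨s₀, s₁⟩, o, d⟩ fun u => ⟨hs₀ u, hs₁ u⟩
  refine SwitchGraph.IsVisits.terminates (t := fun u => 2 * (D u).h + (D u).r) fun v => ?_
  have h₁ := hv _ (isVal_units (name v.val.bits))
  simp only [units_name, units_name_star, VertexData.value, bits_injective.eq_iff, Fin.val_inj,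
    Finset.sum_range, hs₀, hs₁, Finset.sum_sub_distrib, Finset.sum_add_distrib, mul_ite, mul_one,
    mul_zero, Finset.sum_ite_eq', Finset.mem_range, v.2, if_true] at h₁
  have h₂ : ∀ u : Fin n, (2 * (D u).h + (D u).r + 1) / 2 = (D u).h + (D u).r ∧
      (2 * (D u).h + (D u).r) / 2 = (D u).h := by
    intro u
    have := hr u u.2
    omega
  zify
  simp only [SwitchGraph.inflow, h₂, Finset.sum_add_distrib]
  push_cast
  simp only [eq_comm (a := v)]
  simp only [Finset.sum_const_zero] at h₁
  linarith

theorem sum_fiberwise {n : ℕ} (s : Fin n → Fin n) (c g : Fin n → ℤ) :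
    ∑ v, (∑ u, if s u = v then c u else 0) * g v = ∑ u, c u * g (s u) := by
  simp only [Finset.sum_mul, ite_mul, zero_mul]
  rw [Finset.sum_comm]
  simp

/-- The guesses follow a bounded solution `t` of the flow equations, so every place on the ledger
balances. -/
theorem exists_verifier_runs (I : Instance) (h : I.G.Terminates I.o I.d) :
    ∃ S', Runs verifier (5760000 * (I.encode.length + 1) ^ 6) (initial I.encode) S' := by
  obtain ⟨n, G, o, d⟩ := I
  obtain ⟨t, ht, hle⟩ := SwitchGraph.terminates_iff_exists_isVisits.1 h
  simp only [Fintype.card_fin] at ht hle h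
  -- The number of times `u` occurs in the input, so that the starred tokens of `u` cancel.
  let k (u : Fin n) : ℕ := (if o = u then 1 else 0) + (if d = u then 1 else 0) +
    ∑ x, ((if G.s₀ x = u then 1 else 0) + if G.s₁ x = u then 1 else 0)
  let D (u : ℕ) : VertexData := if hu : u < n then ⟨(G.s₀ ⟨u, hu⟩).val.bits,
    (G.s₁ ⟨u, hu⟩).val.bits, k ⟨u, hu⟩, t ⟨u, hu⟩ / 2, t ⟨u, hu⟩ % 2⟩ else ⟨[], [], 0, 0, 0⟩
  have hD : ∀ u : Fin n, D u =
      ⟨(G.s₀ u).val.bits, (G.s₁ u).val.bits, k u, t u / 2, t u % 2⟩ := fun u => dif_pos u.2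
  have hk : ∀ u, k u ≤ 2 * n + 2 := by
    intro u
    have : ∑ x, ((if G.s₀ x = u then 1 else 0) + if G.s₁ x = u then 1 else 0) ≤ ∑ x : Fin n, 2 :=
      Finset.sum_le_sum fun x _ => by split_ifs <;> simp
    simp only [Finset.sum_const, Finset.card_univ, Fintype.card_fin, smul_eq_mul] at this
    simp only [k]
    split_ifs <;> omega
  have hw := map_encode ⟨n, G, o, d⟩ (D := D) fun u => by rw [hD]; exact ⟨rfl, rfl⟩
  generalize Instance.encode ⟨n, G, o, d⟩ = w at hw ⊢
  have hn : n ≤ w.length := by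
    have h₁ := congrArg List.length hw
    have h₂ : (List.map (fun _ => 1) (List.range n)).sum ≤
        (List.map (fun u => (block (D u)).length) (List.range n)).sum :=
      List.sum_le_sum fun u _ => by simp [block]; omega
    simp only [List.length_map, List.length_append, List.length_cons, List.length_flatMap] at h₁
    simp only [List.map_const', List.sum_replicate, List.length_range, smul_eq_mul, mul_one] at h₂
    omega
  have hbits : ∀ u < n, u.bits.length ≤ 2 * w.length := by
    intro u hu
    rw [Nat.size_eq_bits_len, Nat.size_le]
    exact (hu.trans Nat.lt_two_pow_self).trans_le (Nat.pow_le_pow_right (by simp) (by omega))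
  -- The bound `2 * w.length` on bits is needed because `t u / 2 ≤ n * 2 ^ n < 2 ^ (2 * n)` and `n ≤
  -- w.length`.
  have hruns := verifier_complete (2 * w.length) (2 * n + 2) (by omega) hw ?_ ?_
  · obtain ⟨S', hS'⟩ := hruns
    refine ⟨S', hS'.mono ?_⟩
    have h₁ : n * (5 * (2 * n + 2) * (2 * w.length + 1) + 44 * (2 * w.length + 1) ^ 2) ≤
        (w.length + 1) * (5 * (2 * (w.length + 1)) * (2 * (w.length + 1)) +
          44 * (2 * (w.length + 1)) ^ 2) := by
      gcongr <;> omega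
    have h₂ : 40 * (w.length + 1) + 1 ≤ 44 * (w.length + 1) ^ 3 := by
      generalize w.length = L
      nlinarith [Nat.zero_le (L ^ 2), Nat.zero_le (L ^ 3)]
    -- The coefficient 240 is `44 + 196`, where 196 is `5 * 2 * 2 + 44 * 4` from `h₁`. Squaring it
    -- gives `100 * 240 ^ 2 = 5760000`.
    calc _ ≤ 100 * (240 * (w.length + 1) ^ 3) ^ 2 := by
          gcongr
          refine le_trans (b := 44 * (w.length + 1) ^ 3 + 196 * (w.length + 1) ^ 3) ?_ (by omega)
          rw [add_right_comm]
          exact add_le_add h₂ (h₁.trans (by ring_nf; rfl))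
      _ = _ := by ring
  · intro u hu
    obtain ⟨u, rfl⟩ : ∃ x : Fin n, u = x := ⟨⟨u, hu⟩, rfl⟩
    rw [hD]
    refine ⟨hbits _ u.2, hbits _ (G.s₀ u).2, hbits _ (G.s₁ u).2, hk u, ?_, by
      simpa using Nat.le_of_lt_succ (Nat.mod_lt _ (by simp))⟩
    calc t u / 2 ≤ n * 2 ^ n := (Nat.div_le_self _ _).trans (hle u)
      _ < 2 ^ n * 2 ^ n := Nat.mul_lt_mul_of_pos_right Nat.lt_two_pow_self (by positivity)
      _ = 2 ^ (2 * n) := by rw [two_mul, pow_add]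
      _ ≤ 2 ^ (2 * w.length) := Nat.pow_le_pow_right (by simp) (by omega)
  · intro v _
    have h₁ : ∑ u, (k u : ℤ) * v (.star :: name u.val.bits) =
        v (.star :: name o.val.bits) + v (.star :: name d.val.bits) +
          ∑ u, (v (.star :: name (G.s₀ u).val.bits) + v (.star :: name (G.s₁ u).val.bits)) := by
      have e₀ := sum_fiberwise G.s₀ (fun _ => 1) fun u => v (.star :: name u.val.bits)
      have e₁ := sum_fiberwise G.s₁ (fun _ => 1) fun u => v (.star :: name u.val.bits)
      simp only [one_mul] at e₀ e₁
      rw [Finset.sum_add_distrib, ← e₀, ← e₁]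
      simp only [k]
      push_cast
      simp [add_mul, Finset.sum_add_distrib, add_assoc]
    have h₂ : ∑ u, (t u : ℤ) * v (name u.val.bits) + v (name d.val.bits) =
        v (name o.val.bits) + ∑ u, (((t u + 1) / 2 : ℕ) * v (name (G.s₀ u).val.bits) +
          (t u / 2 : ℕ) * v (name (G.s₁ u).val.bits)) := by
      rw [Finset.sum_add_distrib, ← sum_fiberwise G.s₀ _ fun u => v (name u.val.bits),
        ← sum_fiberwise G.s₁ _ fun u => v (name u.val.bits)]
      have h₃ : ∀ u, (t u : ℤ) * v (name u.val.bits) +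
          (if u = d then v (name u.val.bits) else 0) = (if u = o then v (name u.val.bits) else 0) +
            ((∑ x, if G.s₀ x = u then (((t x + 1) / 2 : ℕ) : ℤ) else 0) * v (name u.val.bits) +
              (∑ x, if G.s₁ x = u then ((t x / 2 : ℕ) : ℤ) else 0) * v (name u.val.bits)) := by
        intro u
        have := congrArg (fun m : ℕ => (m : ℤ) * v (name u.val.bits)) (ht u)
        simpa [SwitchGraph.inflow, add_mul, Finset.sum_add_distrib] using this
      have h₄ := Finset.sum_congr (rfl : Finset.univ = Finset.univ) fun u _ => h₃ u
      simpa [Finset.sum_add_distrib] using h₄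
    have h₃ : ∀ u, (((t u + 1) / 2 : ℕ) : ℤ) = (t u / 2 : ℕ) + (t u % 2 : ℕ) ∧
        (t u : ℤ) = 2 * (t u / 2 : ℕ) + (t u % 2 : ℕ) := by
      intro u
      omega
    rw [Finset.sum_range]
    simp only [hD, VertexData.value, Finset.sum_add_distrib, Finset.sum_sub_distrib]
    simp only [Finset.sum_add_distrib, (h₃ _).1] at h₁ h₂
    have h₄ : ∑ u, (t u : ℤ) * v (name u.val.bits) =
        ∑ u : Fin n, (2 * (t u / 2 : ℕ) + (t u % 2 : ℕ)) * v (name u.val.bits) :=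
      Finset.sum_congr rfl fun u _ => by rw [← (h₃ u).2]
    linarith

theorem arrival_mem_NP : ARRIVAL ∈ NP (Option Bool) := by
  refine mem_NP_of_stackProgram ARRIVAL .rev inputSym verifier.matches'
    verifier.isRegular_matches' (5760000 * (Polynomial.X + 1) ^ 6) fun w => ⟨?_, ?_⟩
  · rintro ⟨I, rfl, hI⟩
    obtain ⟨S', c, hc, hl, he⟩ := exists_verifier_runs I hI
    exact ⟨c, by simpa using hl, hc, Option.isSome_iff_exists.2 ⟨S', he⟩⟩
  · rintro ⟨c, hl, hc, he⟩
    obtain ⟨S', he⟩ := Option.isSome_iff_exists.1 he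
    exact mem_ARRIVAL_of_verifier ⟨c, hc, hl, he⟩

end Verifier

end Arrival

theorem mainTheorem1 :
    Arrival.ARRIVAL ∈ Arrival.NP (Option Bool) ∧
    ∀ I : Arrival.Instance, I.o ≠ I.d →
      (I.G.Terminates I.o I.d ↔ ∃ x : I.G.edges → ℕ, I.G.IsSwitchingFlow I.o I.d x) ∧
      (I.G.Terminates I.o I.d →
        I.G.IsSwitchingFlow I.o I.d (I.G.runProfile I.o I.d) ∧
        ∀ e : I.G.edges, I.G.runProfile I.o I.d e ≤ I.n * 2 ^ I.n) := by
  refine ⟨Arrival.Verifier.arrival_mem_NP, fun I hod =>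
    ⟨Arrival.SwitchGraph.terminates_iff_exists_isSwitchingFlow hod, fun h =>
      ⟨Arrival.SwitchGraph.isSwitchingFlow_runProfile hod h, fun e => ?_⟩⟩⟩
  simpa using Arrival.SwitchGraph.runProfile_le h e
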